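/- For integers $m,n\ge 1$ let $\mathcal{AP}_{m,n}$ be the set of absolutely PPT states, i.e. of positive semidefinite matrices $\rho\in M_m(\mathbb C)\otimes M_n(\mathbb C)$ with $\operatorname{Tr}\rho=1$ such that, for every unitary matrix $U$ of order $mn$, the partial transpose $(\mathrm{id}_m\otimes T)(U\rho U^\dagger)$ is positive semidefinite, where $T$ is the transpose map on $M_n(\mathbb C)$. An extreme point of $\mathcal{AP}_{m,n}$ is an extreme point of this convex set; a matrix $A$ is called an unnormalized extreme point of $\mathcal{AP}_{m,n}$ if $cA$ is an extreme point of $\mathcal{AP}_{m,n}$ for some $c>0$. **Theorem.** Let $n>3$, let $\rho\in\mathcal{AP}_{3,n}$, and let $\lambda_1\ge\lambda_2\ge\cdots\ge\lambda_{3n}$ be the eigenvalues of $\rho$, counted with multiplicity. Then $\rho$ is an extreme point of $\mathcal{AP}_{3,n}$ if and only if the following two conditions both hold: (I) the diagonal matrix $\operatorname{diag}(\lambda_1,\lambda_2,\lambda_3,\lambda_{3n-5},\lambda_{3n-4},\lambda_{3n-3},\lambda_{3n-2},\lambda_{3n-1},\lambda_{3n})\in M_3(\mathbb C)\otimes M_3(\mathbb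 C)$ is an unnormalized extreme point of $\mathcal{AP}_{3,3}$; (II) $\lambda_i\in\{\lambda_3,\lambda_{3n-5}\}$ for every integer $i$ with $4\le i\le 3n-6$. -/

import Mathlib

open scoped ComplexOrder

/-- The partial transpose `(id ⊗ T)(A)` of an operator on `ℂ^m ⊗ ℂ^n`: the transposition acts on
the second tensor factor. -/
def partialTranspose {m n : ℕ} (A : Matrix (Fin m × Fin n) (Fin m × Fin n) ℂ) :
    Matrix (Fin m × Fin n) (Fin m × Fin n) ℂ :=
  Matrix.of fun p q => A (p.1, q.2) (q.1, p.2)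

/-- A (normalized) quantum state on `ℂ^m ⊗ ℂ^n`. -/
def IsState {m n : ℕ} (ρ : Matrix (Fin m × Fin n) (Fin m × Fin n) ℂ) : Prop :=
  ρ.PosSemidef ∧ ρ.trace = 1

/-- The set of absolutely PPT states on `ℂ^m ⊗ ℂ^n`: the states whose partial transpose stays
positive semidefinite after conjugation by any unitary matrix of order `m * n`. -/
def absolutelyPPT (m n : ℕ) : Set (Matrix (Fin m × Fin n) (Fin m × Fin n) ℂ) :=
  {ρ | IsState ρ ∧ ∀ U ∈ Matrix.unitaryGroup (Fin m × Fin n) ℂ,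
    (partialTranspose (U * ρ * U.conjTranspose)).PosSemidef}

theorem absolutelyPPT_isHermitian {m n : ℕ} {ρ : Matrix (Fin m × Fin n) (Fin m × Fin n) ℂ}
    (h : ρ ∈ absolutelyPPT m n) : ρ.IsHermitian :=
  h.1.1.isHermitian

/-- `A` is an unnormalized extreme point of the set of absolutely PPT states: a positive multiple
of `A` (necessarily `A / tr A`) is an extreme point of that set. -/
def IsUnnormalizedExtreme {m n : ℕ} (A : Matrix (Fin m × Fin n) (Fin m × Fin n) ℂ) : Prop :=
  ∃ c : ℝ, 0 < c ∧ c • A ∈ Set.extremePoints ℝ (absolutelyPPT m n)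

/-- The `i`-th largest eigenvalue (`i = 1, …, m * n`, counted with multiplicity) of a Hermitian
matrix on `ℂ^m ⊗ ℂ^n`; by convention `0` for other `i`. -/
noncomputable def eigval {m n : ℕ} {A : Matrix (Fin m × Fin n) (Fin m × Fin n) ℂ}
    (hA : A.IsHermitian) (i : ℕ) : ℝ :=
  if h : 1 ≤ i ∧ i ≤ Fintype.card (Fin m × Fin n) then
    hA.eigenvalues₀ ⟨i - 1, by omega⟩
  else 0

/-- The diagonal operator `diag(x₁, …, x₉)` on `ℂ^3 ⊗ ℂ^3`, in the lexicographically ordered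
product basis. -/
def diagNine (x : Fin 9 → ℝ) : Matrix (Fin 3 × Fin 3) (Fin 3 × Fin 3) ℂ :=
  Matrix.diagonal fun p => ((x (finProdFinEquiv p) : ℝ) : ℂ)

/-!
For a vector with Schmidt coefficients `s₁, s₂, s₃`, the partial transpose of its projection has the
eigenvalues `sᵢ²` and `± sᵢ sⱼ` (`i < j`), and `0` otherwise. Testing the partial transpose of
`U ρ Uᴴ` on all such vectors, for all `U`, therefore only involves the spectrum `d` of `ρ`: by
Birkhoff's theorem `ρ` is absolutely PPT iff `∑ ± sᵢ sⱼ d (f (i, j)) ≥ 0` for all real `s` and all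
injective `f`. This is the convex cone `pptCone` (`mem_pptCone_of_partialTranspose_posSemidef`,
`partialTranspose_posSemidef_of_mem_pptCone`). Diagonalizing and pinching, `ρ` is an extreme point
iff its spectrum spans an extreme ray of the cone (`mem_extremePoints_iff_isExtremeRay`): if
`diag d` is a mixture of `A` and `B`, extremality of `d` forces the diagonal of `A` to be `d` and the
spectrum of `A` to be a permutation of `d`, and comparing Hilbert-Schmidt norms leaves no room for
off-diagonal entries.

It remains to compare extreme rays in dimension `N = 3n` and in dimension `9`. By rearrangement, a
decreasing `d` lies in the cone iff the nine-vector `x` of its three largest and six smallest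
entries does (`EndsSorted.mem_pptCone_iff`).

* If a middle entry differs from both of its bounding values, moving it alone stays in the cone, so
  an extreme `d` satisfies the second condition (`IsExtremeRay.eq_or_eq`).
* If `d` is extreme, some form vanishes at some `s ≠ 0`; otherwise `d` would be interior by
  compactness (`IsExtremeRay.exists_pairForm_eq_zero`). If `x = p + q` in the cone, then the form
  vanishes at `s` for `p` too, and also after exchanging two equal entries of `x`. A nonnegative
  form has zero gradient at a zero, and comparing the gradients before and after the exchange shows
  that `p` has equal entries where `x` does (`touches_of_pairCoeff_eq`, `eq_of_pairForm_swap`).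
  Hence `p` extends to a function of the entries of `d`, and a small multiple of it perturbs `d` in
  both directions without disturbing the order; so `p` is a multiple of `x` (`IsExtremeRay.comp_endpoints`).
* Conversely, if `x` is extreme and `d = p + q`, then `p` is a multiple of `d` on the nine ends, and
  substituting a middle index for the end index with the same value gives the same multiple there
  (`isExtremeRay_of_comp_endpoints`).
-/

/-! ### The cone of spectra -/

/-- The sign attached to a pair of indices: for nonnegative Schmidt coefficients, the diagonal
and upper pairs carry the nonnegative eigenvalues of the partial transpose, the lower pairs the
nonpositive ones. -/
def pairSign (a : Fin 3 × Fin 3) : ℝ := if a.1 ≤ a.2 then 1 else -1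

/-- The quadratic form `∑ᵢⱼ ± sᵢ sⱼ d (f (i, j))` in the Schmidt coefficients `s`, where `f` selects
which entry of `d` is paired with which eigenvalue of the partial transpose. -/
def pairForm {ι : Type*} (f : Fin 3 × Fin 3 → ι) (d : ι → ℝ) (s : Fin 3 → ℝ) : ℝ :=
  ∑ a, pairSign a * (s a.1 * s a.2) * d (f a)

/-- The vectors all of whose pair forms are nonnegative. All real `s` are allowed, not only the
nonnegative ones: sign changes of `s` amount to another choice of `f`, and a zero of a form is then
an unconstrained minimum. -/
def pptCone (ι : Type*) : Set (ι → ℝ) :=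
  {d | ∀ f : Fin 3 × Fin 3 → ι, Function.Injective f → ∀ s, 0 ≤ pairForm f d s}

/-- The nonzero vector `d` spans an extreme ray of `pptCone`. -/
def IsExtremeRay {ι : Type*} (d : ι → ℝ) : Prop :=
  d ∈ pptCone ι ∧ d ≠ 0 ∧ ∀ p ∈ pptCone ι, ∀ q ∈ pptCone ι, p + q = d → ∃ c : ℝ, p = c • d

section Cone

variable {ι κ : Type*}

theorem pairForm_add (f : Fin 3 × Fin 3 → ι) (d e : ι → ℝ) (s : Fin 3 → ℝ) :
    pairForm f (d + e) s = pairForm f d s + pairForm f e s := by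
  simp [pairForm, mul_add, Finset.sum_add_distrib]

theorem pairForm_smul (f : Fin 3 × Fin 3 → ι) (c : ℝ) (d : ι → ℝ) (s : Fin 3 → ℝ) :
    pairForm f (c • d) s = c * pairForm f d s := by
  simp only [pairForm, Finset.mul_sum, Pi.smul_apply, smul_eq_mul]
  exact Finset.sum_congr rfl fun _ _ => by ring

theorem pairForm_smul_right (f : Fin 3 × Fin 3 → ι) (c : ℝ) (d : ι → ℝ) (s : Fin 3 → ℝ) :
    pairForm f d (c • s) = c ^ 2 * pairForm f d s := by
  simp only [pairForm, Finset.mul_sum, Pi.smul_apply, smul_eq_mul]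
  exact Finset.sum_congr rfl fun _ _ => by ring

theorem add_mem_pptCone {d e : ι → ℝ} (hd : d ∈ pptCone ι) (he : e ∈ pptCone ι) :
    d + e ∈ pptCone ι := fun f hf s => by
  rw [pairForm_add]; exact add_nonneg (hd f hf s) (he f hf s)

theorem smul_mem_pptCone {d : ι → ℝ} {c : ℝ} (hc : 0 ≤ c) (hd : d ∈ pptCone ι) :
    c • d ∈ pptCone ι := fun f hf s => by
  rw [pairForm_smul]; exact mul_nonneg hc (hd f hf s)

theorem comp_mem_pptCone {d : ι → ℝ} (hd : d ∈ pptCone ι) {g : κ → ι}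
    (hg : Function.Injective g) : d ∘ g ∈ pptCone κ := fun f hf s =>
  hd (g ∘ f) (hg.comp hf) s

/-- Take `s = (1, 0, 0)`; nine available indices are needed for an injective `f` to exist. -/
theorem pptCone_nonneg [Fintype ι] (h9 : 9 ≤ Fintype.card ι) {d : ι → ℝ} (hd : d ∈ pptCone ι)
    (i : ι) : 0 ≤ d i := by
  classical
  obtain ⟨f⟩ : Nonempty (Fin 3 × Fin 3 ↪ ι) :=
    Function.Embedding.nonempty_of_card_le (by simpa using h9)
  have := hd (Equiv.swap (f (0, 0)) i ∘ f) ((Equiv.injective _).comp f.injective) ![1, 0, 0]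
  simpa [pairForm, Fintype.sum_prod_type, Fin.sum_univ_three, pairSign] using this

theorem IsExtremeRay.comp_equiv {d : ι → ℝ} (h : IsExtremeRay d) (e : κ ≃ ι) :
    IsExtremeRay (d ∘ e) := by
  refine ⟨comp_mem_pptCone h.1 e.injective, fun h0 => h.2.1 ?_, fun p hp q hq hpq => ?_⟩
  · ext i
    simpa using congrFun h0 (e.symm i)
  · obtain ⟨c, hc⟩ := h.2.2 (p ∘ e.symm) (comp_mem_pptCone hp e.symm.injective)
      (q ∘ e.symm) (comp_mem_pptCone hq e.symm.injective) (by
        ext i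
        simpa using congrFun hpq (e.symm i))
    refine ⟨c, ?_⟩
    ext i
    simpa using congrFun hc (e i)

theorem isExtremeRay_comp_equiv_iff {d : ι → ℝ} (e : κ ≃ ι) :
    IsExtremeRay (d ∘ e) ↔ IsExtremeRay d := by
  refine ⟨fun h => ?_, fun h => h.comp_equiv e⟩
  have := h.comp_equiv e.symm
  rwa [Function.comp_assoc, e.self_comp_symm, Function.comp_id] at this

theorem IsExtremeRay.exists_smul_of_add_sub {d v : ι → ℝ} (h : IsExtremeRay d)
    (h1 : d + v ∈ pptCone ι) (h2 : d - v ∈ pptCone ι) : ∃ c : ℝ, v = c • d := by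
  obtain ⟨c, hc⟩ := h.2.2 _ (smul_mem_pptCone (c := 1 / 2) (by norm_num) h1) _
    (smul_mem_pptCone (c := 1 / 2) (by norm_num) h2) (by ext i; simp; ring)
  refine ⟨2 * c - 1, ?_⟩
  ext i
  have := congrFun hc i
  simp only [Pi.smul_apply, Pi.add_apply, smul_eq_mul] at this ⊢
  linarith

/-! ### Zeros of the forms -/

/-- The coefficients of the polar form of `pairForm`. -/
def pairCoeff (s u : Fin 3 → ℝ) (a : Fin 3 × Fin 3) : ℝ :=
  pairSign a * (s a.1 * u a.2 + u a.1 * s a.2)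

/-- The gradient of a nonnegative quadratic form vanishes at its zeros. -/
theorem pairForm_polar_eq_zero {d : ι → ℝ} (hd : d ∈ pptCone ι) {f : Fin 3 × Fin 3 → ι}
    (hf : Function.Injective f) {s : Fin 3 → ℝ} (hs : pairForm f d s = 0) (u : Fin 3 → ℝ) :
    ∑ a, pairCoeff s u a * d (f a) = 0 := by
  set B := ∑ a, pairCoeff s u a * d (f a) with hB
  have key : ∀ t : ℝ, pairForm f d (s + t • u) =
      pairForm f d s + t * B + t ^ 2 * pairForm f d u := by
    intro t
    simp only [pairForm, hB, pairCoeff, Finset.mul_sum, ← Finset.sum_add_distrib]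
    refine Finset.sum_congr rfl fun a _ => ?_
    simp only [Pi.add_apply, Pi.smul_apply, smul_eq_mul]
    ring
  have hC := hd f hf u
  set C := pairForm f d u
  -- `t = -B / (C + 1)` makes `t * B + t ^ 2 * C` negative unless `B = 0`
  have h := hd f hf (s + (-B / (C + 1)) • u)
  rw [key, hs] at h
  have hC1 : 0 < C + 1 := by linarith
  have h3 : 0 + -B / (C + 1) * B + (-B / (C + 1)) ^ 2 * C = -(B ^ 2) / (C + 1) ^ 2 := by
    field_simp; ring
  rw [h3, neg_div, neg_nonneg] at h
  have h4 : B ^ 2 ≤ 0 := by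
    by_contra h5
    push Not at h5
    have : 0 < B ^ 2 / (C + 1) ^ 2 := by positivity
    linarith
  exact pow_eq_zero_iff (two_ne_zero) |>.1 (le_antisymm h4 (sq_nonneg B))

/-- The pair `a` contains the index `k`. -/
def Touches (k : Fin 3) (a : Fin 3 × Fin 3) : Prop := a.1 = k ∨ a.2 = k

theorem pairForm_swap_sub (f : Fin 3 × Fin 3 → ι) (d : ι → ℝ) (w : Fin 3 × Fin 3 → ℝ)
    {a b : Fin 3 × Fin 3} (hab : a ≠ b) :
    ∑ c, w c * d (f c) - ∑ c, w c * d (f (Equiv.swap a b c)) =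
      (w a - w b) * (d (f a) - d (f b)) := by
  rw [← Finset.sum_sub_distrib, ← Finset.sum_subset (Finset.subset_univ {a, b})]
  · rw [Finset.sum_pair hab]
    simp only [Equiv.swap_apply_left, Equiv.swap_apply_right]
    ring
  · intro c _ hc
    simp only [Finset.mem_insert, Finset.mem_singleton, not_or] at hc
    rw [Equiv.swap_apply_of_ne_of_ne hc.1 hc.2, sub_self]

/-- If a form vanishes at `s` and `s k = 0`, all entries of `d` paired with a product involving
`s k` agree: permuting them keeps the form zero at `s`, and the gradient in direction `k` then
compares them. -/
theorem eq_of_touches {d : ι → ℝ} (hd : d ∈ pptCone ι) {f : Fin 3 × Fin 3 → ι}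
    (hf : Function.Injective f) {s : Fin 3 → ℝ} (hs0 : s ≠ 0) (hs : pairForm f d s = 0)
    {k : Fin 3} (hk : s k = 0) {a b : Fin 3 × Fin 3} (ha : Touches k a) (hb : Touches k b) :
    d (f a) = d (f b) := by
  classical
  obtain ⟨l, hl⟩ : ∃ l, s l ≠ 0 := by
    by_contra h
    push Not at h
    exact hs0 (funext h)
  have hkl : k ≠ l := fun h => hl (h ▸ hk)
  rcases eq_or_ne a b with rfl | hab
  · rfl
  -- the entries touching `k` do not contribute to the form at `s`
  have hperm : ∀ σ : Equiv.Perm (Fin 3 × Fin 3), (∀ c, ¬ Touches k c → σ c = c) →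
      pairForm (f ∘ σ) d s = 0 := by
    intro σ hσ
    rw [← hs]
    refine Finset.sum_congr rfl fun c _ => ?_
    by_cases hc : Touches k c
    · have : s c.1 * s c.2 = 0 := by rcases hc with h | h <;> simp [h, hk]
      simp [this]
    · simp [hσ c hc]
  have hswap : ∀ c e : Fin 3 × Fin 3, Touches k c → Touches k e →
      ∀ x, ¬ Touches k x → Equiv.swap c e x = x := fun c e hc he x hx =>
    Equiv.swap_apply_of_ne_of_ne (fun h => hx (h ▸ hc)) (fun h => hx (h ▸ he))
  have base : ∀ σ : Equiv.Perm (Fin 3 × Fin 3), (∀ c, ¬ Touches k c → σ c = c) →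
      d (f (σ (k, l))) = d (f (σ (l, k))) := by
    intro σ hσ
    have hne : ((k, l) : Fin 3 × Fin 3) ≠ (l, k) := fun h => hkl (congrArg Prod.fst h)
    have h1 := pairForm_polar_eq_zero hd (hf.comp σ.injective) (hperm σ hσ) (Pi.single k 1)
    have h2 := pairForm_polar_eq_zero hd
      (hf.comp ((Equiv.injective (σ * Equiv.swap (k, l) (l, k)))))
      (hperm (σ * Equiv.swap (k, l) (l, k)) (fun c hc => by
        rw [Equiv.Perm.mul_apply, hswap _ _ (Or.inl rfl) (Or.inr rfl) c hc, hσ c hc]))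
      (Pi.single k 1)
    have h3 := pairForm_swap_sub (f ∘ σ) d (pairCoeff s (Pi.single k 1)) hne
    simp only [Function.comp_apply, Equiv.Perm.mul_apply] at h1 h2 h3
    rw [h1, h2, sub_zero] at h3
    have h4 : pairCoeff s (Pi.single k 1) (k, l) - pairCoeff s (Pi.single k 1) (l, k) ≠ 0 := by
      simp only [pairCoeff, pairSign, hk, Pi.single_eq_same, zero_mul, mul_zero,
        zero_add, one_mul, mul_one, add_zero]
      rcases lt_or_gt_of_ne hkl with h | h
      · rw [if_pos h.le, if_neg (not_le.2 h)]
        intro h5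
        apply hl
        linarith
      · rw [if_neg (not_le.2 h), if_pos h.le]
        intro h5
        apply hl
        linarith
    rcases mul_eq_zero.1 h3.symm with h | h
    · exact absurd h h4
    · linarith
  have key : ∀ c, Touches k c → d (f c) = d (f (k, l)) := by
    intro c hc
    have h0 : d (f (k, l)) = d (f (l, k)) := base 1 (fun _ _ => rfl)
    rcases eq_or_ne c (k, l) with rfl | h1
    · rfl
    rcases eq_or_ne c (l, k) with rfl | h2
    · exact h0.symm
    have h3 := base (Equiv.swap (k, l) c) (hswap _ _ (Or.inl rfl) hc)
    rw [Equiv.swap_apply_left, Equiv.swap_apply_of_ne_of_ne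
      (fun h => hkl (congrArg Prod.snd h)) h2.symm] at h3
    rw [h3, h0]
  rw [key a ha, key b hb]

set_option maxHeartbeats 1000000 in
/-- Two distinct signed monomials `± sᵢ sⱼ` have the same gradient at `s ≠ 0` only if each of them
contains a coordinate at which `s` vanishes (possibly not the same one). -/
theorem touches_of_pairCoeff_eq {s : Fin 3 → ℝ} (hs0 : s ≠ 0) {a b : Fin 3 × Fin 3} (hab : a ≠ b)
    (h : ∀ k, pairCoeff s (Pi.single k 1) a = pairCoeff s (Pi.single k 1) b) :
    ∃ k l, s k = 0 ∧ s l = 0 ∧ Touches k a ∧ Touches l b := by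
  have h0 := h 0
  have h1 := h 1
  have h2 := h 2
  have hs : s 0 ≠ 0 ∨ s 1 ≠ 0 ∨ s 2 ≠ 0 := by
    by_contra hc
    push Not at hc
    exact hs0 (by ext i; fin_cases i <;> simp [hc])
  simp only [Fin.exists_fin_succ, Touches]
  obtain ⟨a1, a2⟩ := a
  obtain ⟨b1, b2⟩ := b
  fin_cases a1 <;> fin_cases a2 <;> fin_cases b1 <;> fin_cases b2 <;>
    first
    | exact absurd rfl hab
    | (simp [pairCoeff, pairSign] at h0 h1 h2 ⊢
       grind)

/-- If a form vanishes at `s ≠ 0` both before and after two entries of `d` are exchanged, these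
entries are equal. -/
theorem eq_of_pairForm_swap {d : ι → ℝ} (hd : d ∈ pptCone ι) {f : Fin 3 × Fin 3 → ι}
    (hf : Function.Injective f) {s : Fin 3 → ℝ} (hs0 : s ≠ 0) {a b : Fin 3 × Fin 3}
    (h1 : pairForm f d s = 0) (h2 : pairForm (f ∘ Equiv.swap a b) d s = 0) :
    d (f a) = d (f b) := by
  classical
  rcases eq_or_ne a b with rfl | hab
  · rfl
  by_contra hne
  have h : ∀ k, pairCoeff s (Pi.single k 1) a = pairCoeff s (Pi.single k 1) b := by
    intro k
    have h3 := pairForm_polar_eq_zero hd hf h1 (Pi.single k 1)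
    have h4 := pairForm_polar_eq_zero hd (hf.comp (Equiv.injective _)) h2 (Pi.single k 1)
    have h5 := pairForm_swap_sub f d (pairCoeff s (Pi.single k 1)) hab
    simp only [Function.comp_apply] at h4
    rw [h3, h4, sub_zero] at h5
    rcases mul_eq_zero.1 h5.symm with h | h
    · exact sub_eq_zero.1 h
    · exact absurd (sub_eq_zero.1 h) hne
  obtain ⟨k, l, hk, hl, ha, hb⟩ := touches_of_pairCoeff_eq hs0 hab h
  apply hne
  -- the pair `(k, l)` contains both vanishing coordinates and links the two entries
  rw [eq_of_touches hd hf hs0 h1 hk ha (b := (k, l)) (Or.inl rfl),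
    eq_of_touches hd hf hs0 h1 hl (a := (k, l)) (Or.inr rfl) hb]

/-! ### Interior points of the cone -/

/-- A vector with positive definite pair forms is interior, by compactness of the sphere. -/
theorem eventually_add_smul_mem_pptCone [Finite ι] {d : ι → ℝ}
    (hd : ∀ f : Fin 3 × Fin 3 → ι, Function.Injective f → ∀ s, s ≠ 0 → 0 < pairForm f d s)
    (v : ι → ℝ) : ∀ᶠ t in nhds (0 : ℝ), d + t • v ∈ pptCone ι := by
  have h1 : ∀ᶠ t in nhds (0 : ℝ), ∀ f : Fin 3 × Fin 3 → ι, Function.Injective f →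
      ∀ s ∈ Metric.sphere (0 : Fin 3 → ℝ) 1, 0 ≤ pairForm f (d + t • v) s := by
    rw [Filter.eventually_all]
    intro f
    by_cases hf : Function.Injective f
    · have : ∀ᶠ t in nhds (0 : ℝ), ∀ s ∈ Metric.sphere (0 : Fin 3 → ℝ) 1,
          0 ≤ pairForm f (d + t • v) s := by
        apply IsCompact.eventually_forall_of_forall_eventually (isCompact_sphere _ _)
        intro s hs
        have hc : Continuous fun z : ℝ × (Fin 3 → ℝ) => pairForm f (d + z.1 • v) z.2 := by
          unfold pairForm
          simp only [Pi.add_apply, Pi.smul_apply]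
          fun_prop
        have hs1 : s ≠ 0 := by
          rintro rfl
          simp at hs
        have h0 : 0 < pairForm f (d + (0 : ℝ) • v) s := by simpa using hd f hf s hs1
        exact ((hc.tendsto (0, s)).eventually (lt_mem_nhds h0)).mono fun _ h => h.le
      filter_upwards [this] with t ht _ using ht
    · simp [hf]
  filter_upwards [h1] with t ht f hf s
  rcases eq_or_ne s 0 with rfl | hs
  · simp [pairForm]
  have hn : 0 < ‖s‖ := norm_pos_iff.2 hs
  have h2 := ht f hf (‖s‖⁻¹ • s) (by simp [norm_smul, hn.ne'])
  rw [pairForm_smul_right] at h2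
  exact nonneg_of_mul_nonneg_right h2 (by positivity)

end Cone

/-! ### Rearrangement: only the ends of the spectrum matter -/

section Rearrangement

theorem exists_strictMono_comp_perm {k : ℕ} {α : Type*} [LinearOrder α] {f : Fin k → α}
    (hf : Function.Injective f) : ∃ σ : Equiv.Perm (Fin k), StrictMono (f ∘ σ) :=
  ⟨Tuple.sort f, (Tuple.monotone_sort f).strictMono_of_injective
    (hf.comp (Equiv.injective _))⟩

/-- Signs of `s` are absorbed by exchanging the pairs `(i, j)` and `(j, i)` for which
`sᵢ sⱼ < 0`. -/
theorem pairForm_abs {ι : Type*} (f : Fin 3 × Fin 3 → ι) (hf : Function.Injective f) (d : ι → ℝ)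
    (s : Fin 3 → ℝ) : ∃ f' : Fin 3 × Fin 3 → ι, Function.Injective f' ∧
      pairForm f d s = pairForm f' d |s| := by
  set θ : Fin 3 × Fin 3 → Fin 3 × Fin 3 := fun a => if s a.1 * s a.2 < 0 then a.swap else a with hθ
  have hinv : Function.Involutive θ := by
    intro a
    by_cases h : s a.1 * s a.2 < 0
    · have h' : s a.2 * s a.1 < 0 := by rwa [mul_comm]
      simp [hθ, h, h']
    · simp [hθ, h]
  refine ⟨f ∘ θ, hf.comp hinv.injective, ?_⟩
  rw [pairForm, ← Equiv.sum_comp hinv.toPerm]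
  refine Finset.sum_congr rfl fun a _ => ?_
  simp only [Function.Involutive.coe_toPerm, Function.comp_apply, Pi.abs_apply, ← abs_mul]
  congr 1
  by_cases h : s a.1 * s a.2 < 0
  · have hne : a.1 ≠ a.2 := by
      intro h1
      rw [h1] at h
      exact absurd h (not_lt.2 (mul_self_nonneg _))
    have hθa : θ a = a.swap := by simp [hθ, h]
    rw [hθa, abs_of_neg h]
    simp only [pairSign, Prod.fst_swap, Prod.snd_swap]
    rcases lt_or_gt_of_ne hne with h1 | h1
    · rw [if_pos h1.le, if_neg (not_le.2 h1)]; ring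
    · rw [if_neg (not_le.2 h1), if_pos h1.le]; ring
  · have hθa : θ a = a := by simp [hθ, h]
    rw [hθa, abs_of_nonneg (not_lt.1 h)]

/-- The positions of the three first and six last entries among `N`. -/
def endpoints {N : ℕ} (hN : 9 ≤ N) (k : Fin 9) : Fin N :=
  if (k : ℕ) < 3 then ⟨k, by omega⟩ else ⟨N - 9 + k, by omega⟩

theorem endpoints_strictMono {N : ℕ} (hN : 9 ≤ N) : StrictMono (endpoints hN) := by
  intro a b hab
  rw [Fin.lt_def] at hab ⊢
  unfold endpoints
  split_ifs <;> simp <;> omega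

theorem endpoints_castAdd {N : ℕ} (hN : 9 ≤ N) (k : Fin 3) :
    endpoints hN (Fin.castAdd 6 k) = ⟨k, by omega⟩ := by
  simp [endpoints]

theorem endpoints_natAdd {N : ℕ} (hN : 9 ≤ N) (k : Fin 6) :
    endpoints hN (Fin.natAdd 3 k) = ⟨N - 6 + k, by omega⟩ := by
  have hk : ((Fin.natAdd 3 k : Fin 9) : ℕ) = 3 + k := rfl
  rw [endpoints, if_neg (by omega)]
  apply Fin.ext
  simp only [hk]
  omega

/-- The first three entries dominate all later entries and the last six are dominated by all earlier
entries; nothing is required between the middle entries. -/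
structure EndsSorted {N : ℕ} (d : Fin N → ℝ) : Prop where
  top : ∀ i j : Fin N, (j : ℕ) < 3 → j ≤ i → d i ≤ d j
  bottom : ∀ i j : Fin N, N - 6 ≤ (j : ℕ) → i ≤ j → d j ≤ d i

theorem Antitone.endsSorted {N : ℕ} {d : Fin N → ℝ} (hd : Antitone d) : EndsSorted d :=
  ⟨fun _ _ _ h => hd h, fun _ _ _ h => hd h⟩

theorem StrictMono.val_le_apply {k N : ℕ} {f : Fin k → Fin N} (hf : StrictMono f) (j : Fin k) :
    (j : ℕ) ≤ f j := by
  obtain ⟨j, hj⟩ := j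
  induction j with
  | zero => exact Nat.zero_le _
  | succ j ih =>
    have h1 := ih (by omega)
    have h2 : f ⟨j, by omega⟩ < f ⟨j + 1, hj⟩ := hf (by simp [Fin.lt_def])
    rw [Fin.lt_def] at h2
    simp only at h1 ⊢
    omega

theorem StrictMono.apply_add_le {k N : ℕ} {f : Fin k → Fin N} (hf : StrictMono f) (j : Fin k) :
    (f j : ℕ) + k ≤ N + j := by
  have hg : StrictMono fun i : Fin k => (f i.rev).rev := fun a b hab =>
    Fin.rev_lt_rev.2 (hf (Fin.rev_lt_rev.2 hab))
  have := hg.val_le_apply j.rev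
  simp only [Fin.rev_rev, Fin.val_rev] at this
  omega

/-- The smallest pair forms use the endpoints: sorted, the three entries with negative coefficients
are at most the first three, and the six with nonnegative coefficients at least the last six. -/
theorem exists_endpoints_pairForm_le {N : ℕ} (hN : 9 ≤ N) {d : Fin N → ℝ} (hd : EndsSorted d)
    {f : Fin 3 × Fin 3 → Fin N} (hf : Function.Injective f) (s : Fin 3 → ℝ) :
    ∃ e : Fin 3 × Fin 3 → Fin 9, Function.Injective e ∧
      pairForm e (d ∘ endpoints hN) |s| ≤ pairForm f d s := by
  obtain ⟨f, hf, hfs⟩ := pairForm_abs f hf d s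
  rw [hfs]
  have hs : ∀ i, 0 ≤ |s| i := fun i => abs_nonneg _
  generalize |s| = s at hs
  clear hfs
  set P : Fin 3 × Fin 3 → Prop := fun a => ¬ a.1 ≤ a.2
  obtain ⟨c, hc1, hc2⟩ : ∃ c : Fin 3 ⊕ Fin 6 ≃ Fin 3 × Fin 3,
      (∀ k, ¬ (c (Sum.inl k)).1 ≤ (c (Sum.inl k)).2) ∧
      (∀ k, (c (Sum.inr k)).1 ≤ (c (Sum.inr k)).2) := by
    let α : Fin 3 ≃ {a // P a} := (Fintype.equivFinOfCardEq (by decide)).symm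
    let β : Fin 6 ≃ {a // ¬ P a} := (Fintype.equivFinOfCardEq (by decide)).symm
    refine ⟨(Equiv.sumCongr α β).trans (Equiv.sumCompl P), fun k => ?_, fun k => ?_⟩
    · exact (α k).2
    · exact not_not.1 (β k).2
  obtain ⟨σ, hσ⟩ := exists_strictMono_comp_perm
    (f := fun k => f (c (Sum.inl k))) (hf.comp (c.injective.comp Sum.inl_injective))
  obtain ⟨τ, hτ⟩ := exists_strictMono_comp_perm
    (f := fun k => f (c (Sum.inr k))) (hf.comp (c.injective.comp Sum.inr_injective))
  set e : Fin 3 × Fin 3 ≃ Fin 9 :=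
    (c.symm.trans (Equiv.sumCongr σ.symm τ.symm)).trans finSumFinEquiv with he
  have he1 : ∀ k, e (c (Sum.inl (σ k))) = Fin.castAdd 6 k := by intro k; simp [he]; rfl
  have he2 : ∀ k, e (c (Sum.inr (τ k))) = Fin.natAdd 3 k := by intro k; simp [he]; rfl
  have split : ∀ W : Fin 3 × Fin 3 → ℝ, ∑ a, W a =
      ∑ k, W (c (Sum.inl (σ k))) + ∑ k, W (c (Sum.inr (τ k))) := by
    intro W
    rw [← Equiv.sum_comp c, Fintype.sum_sum_type, ← Equiv.sum_comp σ,
      ← Equiv.sum_comp τ]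
  refine ⟨e, e.injective, ?_⟩
  rw [pairForm, pairForm, split, split]
  refine add_le_add (Finset.sum_le_sum fun k _ => ?_) (Finset.sum_le_sum fun k _ => ?_)
  · refine mul_le_mul_of_nonpos_left ?_ ?_
    · rw [he1, Function.comp_apply, endpoints_castAdd]
      exact hd.top _ _ k.2 (hσ.val_le_apply k)
    · rw [pairSign, if_neg (hc1 _), neg_one_mul, neg_nonpos]
      exact mul_nonneg (hs _) (hs _)
  · refine mul_le_mul_of_nonneg_left ?_ ?_
    · rw [he2, Function.comp_apply, endpoints_natAdd]
      refine hd.bottom _ _ (by simp) ?_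
      have := hτ.apply_add_le k
      rw [Fin.le_def]
      simp only [Function.comp_apply] at this ⊢
      omega
    · rw [pairSign, if_pos (hc2 _), one_mul]
      exact mul_nonneg (hs _) (hs _)

theorem EndsSorted.mem_pptCone_iff {N : ℕ} (hN : 9 ≤ N) {d : Fin N → ℝ} (hd : EndsSorted d) :
    d ∈ pptCone (Fin N) ↔ d ∘ endpoints hN ∈ pptCone (Fin 9) := by
  refine ⟨fun h => comp_mem_pptCone h (endpoints_strictMono hN).injective, fun h f hf s => ?_⟩
  obtain ⟨e, he, hle⟩ := exists_endpoints_pairForm_le hN hd hf s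
  exact (h e he _).trans hle

end Rearrangement

/-! ### Extreme rays in dimension `N` and in dimension nine -/

section ExtremeRays

variable {N : ℕ}

theorem endpoints_two (hN : 9 ≤ N) : endpoints hN 2 = ⟨2, by omega⟩ := rfl

theorem endpoints_three (hN : 9 ≤ N) : endpoints hN 3 = ⟨N - 6, by omega⟩ := by
  simp only [endpoints]
  rw [if_neg (by decide)]
  apply Fin.ext
  simp
  omega

theorem mem_range_endpoints (hN : 9 ≤ N) {i : Fin N} (hi : (i : ℕ) < 3 ∨ N - 6 ≤ (i : ℕ)) :
    ∃ k, endpoints hN k = i := by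
  rcases hi with h | h
  · exact ⟨Fin.castAdd 6 ⟨i, h⟩, by rw [endpoints_castAdd]⟩
  · refine ⟨Fin.natAdd 3 (⟨i - (N - 6), by omega⟩ : Fin 6), ?_⟩
    rw [endpoints_natAdd]
    apply Fin.ext
    simp
    omega

theorem endpoints_val (hN : 9 ≤ N) (k : Fin 9) :
    (endpoints hN k : ℕ) < 3 ∨ N - 6 ≤ (endpoints hN k : ℕ) := by
  unfold endpoints
  split_ifs with h
  · exact Or.inl h
  · right; simp; omega

/-- The middle entries of an extreme ray take only two values. -/
theorem IsExtremeRay.eq_or_eq (hN : 9 ≤ N) {d : Fin N → ℝ} (hd : Antitone d)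
    (h : IsExtremeRay d) (i : Fin N) (h3 : 3 ≤ (i : ℕ)) (h6 : (i : ℕ) < N - 6) :
    d i = d (endpoints hN 2) ∨ d i = d (endpoints hN 3) := by
  by_contra hc
  push Not at hc
  rw [endpoints_two, endpoints_three] at hc
  have h1 : d i < d ⟨2, by omega⟩ := lt_of_le_of_ne (hd (by rw [Fin.le_def]; simp; omega)) hc.1
  have h2 : d ⟨N - 6, by omega⟩ < d i :=
    lt_of_le_of_ne (hd (by rw [Fin.le_def]; simp; omega)) hc.2.symm
  -- the largest step that keeps the middle entry between its bounds
  set t := min (d ⟨2, by omega⟩ - d i) (d i - d ⟨N - 6, by omega⟩) with ht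
  have ht0 : 0 < t := lt_min (by linarith) (by linarith)
  have ht1 : t ≤ d ⟨2, by omega⟩ - d i := min_le_left _ _
  have ht2 : t ≤ d i - d ⟨N - 6, by omega⟩ := min_le_right _ _
  have key : ∀ r : ℝ, |r| ≤ t → d + Pi.single i r ∈ pptCone (Fin N) := by
    intro r hr
    rw [abs_le] at hr
    have hsort : EndsSorted (d + Pi.single i r) := by
      constructor
      · intro a b hb hab
        have hbi : b ≠ i := by rintro rfl; omega
        rcases eq_or_ne a i with rfl | ha
        · have : d ⟨2, by omega⟩ ≤ d b := hd (by rw [Fin.le_def]; simp; omega)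
          simp [hbi]; linarith
        · simpa [hbi, ha] using hd hab
      · intro a b hb hab
        have hbi : b ≠ i := by rintro rfl; omega
        rcases eq_or_ne a i with rfl | ha
        · have : d b ≤ d ⟨N - 6, by omega⟩ := hd (by rw [Fin.le_def]; simpa using hb)
          simp [hbi]; linarith
        · simpa [hbi, ha] using hd hab
    rw [hsort.mem_pptCone_iff hN]
    have : (d + Pi.single i r) ∘ endpoints hN = d ∘ endpoints hN := by
      ext k
      have : endpoints hN k ≠ i := by
        intro hk
        have := endpoints_val hN k
        rw [hk] at this
        omega
      simp [this]
    rw [this]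
    exact comp_mem_pptCone h.1 (endpoints_strictMono hN).injective
  obtain ⟨c, hc'⟩ := h.exists_smul_of_add_sub (v := Pi.single i t)
    (key t (abs_of_pos ht0).le) (by
      have := key (-t) (by rw [abs_neg, abs_of_pos ht0])
      rwa [Pi.single_neg, ← sub_eq_add_neg] at this)
  have hpos := pptCone_nonneg (by simpa using hN) h.1 ⟨N - 6, by omega⟩
  have e1 := congrFun hc' ⟨2, by omega⟩
  have e2 := congrFun hc' i
  rw [Pi.single_eq_of_ne (by rw [Ne, Fin.ext_iff]; simp; omega)] at e1
  simp only [Pi.single_eq_same, Pi.smul_apply, smul_eq_mul] at e1 e2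
  rcases mul_eq_zero.1 e1.symm with h0 | h0
  · rw [h0] at e2; linarith
  · linarith

/-- An extreme ray is not interior, hence some form vanishes, already on the endpoints. -/
theorem IsExtremeRay.exists_pairForm_eq_zero (hN : 9 ≤ N) {d : Fin N → ℝ} (hd : Antitone d)
    (h : IsExtremeRay d) : ∃ e : Fin 3 × Fin 3 → Fin 9, Function.Injective e ∧
      ∃ s ≠ 0, pairForm e (d ∘ endpoints hN) s = 0 := by
  by_contra hc
  push Not at hc
  have hpos : ∀ f : Fin 3 × Fin 3 → Fin N, Function.Injective f → ∀ s, s ≠ 0 →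
      0 < pairForm f d s := by
    intro f hf s hs
    obtain ⟨e, he, hle⟩ := exists_endpoints_pairForm_le hN hd.endsSorted hf s
    refine lt_of_lt_of_le (lt_of_le_of_ne ?_ (hc e he |s| (by simpa using hs)).symm) hle
    exact comp_mem_pptCone h.1 (endpoints_strictMono hN).injective e he _
  have hpert : ∀ v : Fin N → ℝ, ∃ c : ℝ, v = c • d := by
    intro v
    have h1 := eventually_add_smul_mem_pptCone hpos v
    have h2 := eventually_add_smul_mem_pptCone hpos (-v)
    obtain ⟨t, ⟨ht1, ht2⟩, ht0⟩ := ((h1.and h2).filter_mono nhdsWithin_le_nhds |>.and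
      (self_mem_nhdsWithin (s := Set.Ioi (0 : ℝ)))).exists
    obtain ⟨c, hc⟩ := h.exists_smul_of_add_sub ht1
      (by rwa [smul_neg, ← sub_eq_add_neg] at ht2)
    refine ⟨t⁻¹ * c, ?_⟩
    rw [mul_smul, ← hc, smul_smul, inv_mul_cancel₀ (ne_of_gt ht0), one_smul]
  -- then two different unit vectors would both be multiples of `d`
  obtain ⟨a, ha⟩ := hpert (Pi.single ⟨0, by omega⟩ 1)
  obtain ⟨b, hb⟩ := hpert (Pi.single ⟨1, by omega⟩ 1)
  have a0 := congrFun ha ⟨0, by omega⟩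
  have a1 := congrFun ha ⟨1, by omega⟩
  have b0 := congrFun hb ⟨0, by omega⟩
  have b1 := congrFun hb ⟨1, by omega⟩
  simp at a0 a1 b0 b1
  rcases a1 with h1 | h1
  · simp [h1] at a0
  · simp [h1] at b1

/-- Summands of a boundary vector `x` inside the cone are constant where `x` is. -/
theorem eq_of_add_eq_of_pairForm_eq_zero {x p q : Fin 9 → ℝ} (hp : p ∈ pptCone (Fin 9))
    (hq : q ∈ pptCone (Fin 9)) (hpq : p + q = x) {e : Fin 3 × Fin 3 → Fin 9}
    (he : Function.Injective e) {s : Fin 3 → ℝ} (hs : s ≠ 0) (h0 : pairForm e x s = 0)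
    {i j : Fin 9} (hij : x i = x j) : p i = p j := by
  have hbij : Function.Bijective e :=
    (Fintype.bijective_iff_injective_and_card e).2 ⟨he, by simp⟩
  obtain ⟨a, rfl⟩ := hbij.2 i
  obtain ⟨b, rfl⟩ := hbij.2 j
  have hact : ∀ f : Fin 3 × Fin 3 → Fin 9, Function.Injective f → pairForm f x s = 0 →
      pairForm f p s = 0 := by
    intro f hf h
    have h1 := hp f hf s
    have h2 := hq f hf s
    rw [← hpq, pairForm_add] at h
    linarith
  refine eq_of_pairForm_swap hp he hs (hact e he h0)
    (hact _ (he.comp (Equiv.injective _)) ?_)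
  rw [← h0]
  refine Finset.sum_congr rfl fun c _ => ?_
  congr 1
  simp only [Function.comp_apply]
  rcases eq_or_ne c a with rfl | h1
  · rw [Equiv.swap_apply_left, hij]
  rcases eq_or_ne c b with rfl | h2
  · rw [Equiv.swap_apply_right, hij]
  rw [Equiv.swap_apply_of_ne_of_ne h1 h2]

/-- A perturbation that respects the ties of `d` preserves the order for small times. -/
theorem eventually_antitone_add_smul {d v : Fin N → ℝ} (hd : Antitone d)
    (hv : ∀ i j, d i = d j → v i = v j) : ∀ᶠ t in nhds (0 : ℝ), Antitone (d + t • v) := by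
  have : ∀ᶠ t in nhds (0 : ℝ), ∀ i j, i ≤ j → (d + t • v) j ≤ (d + t • v) i := by
    simp only [Filter.eventually_all]
    intro i j hij
    rcases (hd hij).eq_or_lt with h | h
    · refine Filter.Eventually.of_forall fun t => ?_
      simp [h, hv _ _ h]
    · have hc : Continuous fun t : ℝ => (d + t • v) i - (d + t • v) j := by
        simp only [Pi.add_apply, Pi.smul_apply]
        fun_prop
      have h0 : 0 < (d + (0 : ℝ) • v) i - (d + (0 : ℝ) • v) j := by simpa using h
      filter_upwards [(hc.tendsto 0).eventually (lt_mem_nhds h0)] with t ht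
      exact (sub_pos.1 ht).le
  filter_upwards [this] with t ht i j hij using ht i j hij

theorem IsExtremeRay.comp_endpoints (hN : 9 ≤ N) {d : Fin N → ℝ} (hd : Antitone d)
    (h : IsExtremeRay d) : IsExtremeRay (d ∘ endpoints hN) := by
  have hinj := (endpoints_strictMono hN).injective
  have hmem := comp_mem_pptCone h.1 hinj
  refine ⟨hmem, fun h0 => h.2.1 ?_, fun p hp q hq hpq => ?_⟩
  · ext i
    refine le_antisymm ?_ (pptCone_nonneg (by simpa using hN) h.1 i)
    have := congrFun h0 0
    calc d i ≤ d (endpoints hN 0) := hd (by rw [Fin.le_def]; simp [endpoints])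
      _ = 0 := this
  obtain ⟨e, he, s, hs, hact⟩ := h.exists_pairForm_eq_zero hN hd
  have htie : ∀ i j, (d ∘ endpoints hN) i = (d ∘ endpoints hN) j → p i = p j := fun i j hij =>
    eq_of_add_eq_of_pairForm_eq_zero hp hq hpq he hs hact hij
  have hex : ∀ i, ∃ k, d (endpoints hN k) = d i := by
    intro i
    by_cases hi : (i : ℕ) < 3 ∨ N - 6 ≤ (i : ℕ)
    · obtain ⟨k, hk⟩ := mem_range_endpoints hN hi
      exact ⟨k, by rw [hk]⟩
    · push Not at hi
      rcases h.eq_or_eq hN hd i hi.1 hi.2 with h | h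
      · exact ⟨2, h.symm⟩
      · exact ⟨3, h.symm⟩
  -- extend `p` to all indices as a function of the entries of `d`
  choose κ hκ using hex
  have hPg : (p ∘ κ) ∘ endpoints hN = p := by
    ext k
    exact htie _ _ (hκ _)
  have hPtie : ∀ i j, d i = d j → (p ∘ κ) i = (p ∘ κ) j := fun i j hij =>
    htie _ _ (by simp only [Function.comp_apply, hκ, hij])
  have hPtie' : ∀ i j, d i = d j → (-(p ∘ κ)) i = (-(p ∘ κ)) j := fun i j hij => by
    rw [Pi.neg_apply, Pi.neg_apply, hPtie i j hij]
  obtain ⟨t, ⟨⟨ht1, ht2⟩, ht3⟩, ht0⟩ :=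
    (((eventually_antitone_add_smul hd hPtie).and
      (eventually_antitone_add_smul hd hPtie')).and (gt_mem_nhds one_pos)
      |>.filter_mono nhdsWithin_le_nhds |>.and
      (self_mem_nhdsWithin (s := Set.Ioi (0 : ℝ)))).exists
  replace ht0 : 0 < t := ht0
  have m1 : d + t • (p ∘ κ) ∈ pptCone (Fin N) := by
    rw [ht1.endsSorted.mem_pptCone_iff hN]
    have : (d + t • (p ∘ κ)) ∘ endpoints hN = d ∘ endpoints hN + t • p := by
      conv_rhs => rw [← hPg]
      rfl
    rw [this]
    exact add_mem_pptCone hmem (smul_mem_pptCone ht0.le hp)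
  have m2 : d - t • (p ∘ κ) ∈ pptCone (Fin N) := by
    rw [smul_neg, ← sub_eq_add_neg] at ht2
    rw [ht2.endsSorted.mem_pptCone_iff hN]
    have : (d - t • (p ∘ κ)) ∘ endpoints hN = (1 - t) • p + q := by
      have h1 : (d - t • (p ∘ κ)) ∘ endpoints hN = d ∘ endpoints hN - t • p := by
        conv_rhs => rw [← hPg]
        rfl
      rw [h1, ← hpq, sub_smul, one_smul]
      abel
    rw [this]
    exact add_mem_pptCone (smul_mem_pptCone (by linarith) hp) hq
  obtain ⟨c, hc⟩ := h.exists_smul_of_add_sub m1 m2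
  refine ⟨t⁻¹ * c, ?_⟩
  ext k
  have h1 := congrFun hc (endpoints hN k)
  have h2 := congrFun hPg k
  simp only [Pi.smul_apply, Function.comp_apply, smul_eq_mul] at h1 h2 ⊢
  rw [h2] at h1
  rw [mul_assoc, ← h1, inv_mul_cancel_left₀ ht0.ne']

theorem isExtremeRay_of_comp_endpoints (hN : 9 ≤ N) {d : Fin N → ℝ} (hd : Antitone d)
    (hmem : d ∈ pptCone (Fin N)) (h : IsExtremeRay (d ∘ endpoints hN))
    (hmid : ∀ i : Fin N, 3 ≤ (i : ℕ) → (i : ℕ) < N - 6 →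
      d i = d (endpoints hN 2) ∨ d i = d (endpoints hN 3)) : IsExtremeRay d := by
  have hinj := (endpoints_strictMono hN).injective
  refine ⟨hmem, fun h0 => h.2.1 (by rw [h0]; rfl), fun p hp q hq hpq => ?_⟩
  have hsel : ∀ g : Fin 9 → Fin N, Function.Injective g → d ∘ g = d ∘ endpoints hN →
      ∃ c : ℝ, p ∘ g = c • (d ∘ endpoints hN) := fun g hg hgd =>
    h.2.2 _ (comp_mem_pptCone hp hg) _ (comp_mem_pptCone hq hg) (by rw [← hgd, ← hpq]; rfl)
  have hne : d (endpoints hN 0) ≠ 0 := by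
    intro h0
    apply h.2.1
    ext k
    refine le_antisymm ?_ (pptCone_nonneg (by simp) h.1 k)
    exact (hd ((endpoints_strictMono hN).monotone (Fin.zero_le k))).trans h0.le
  obtain ⟨c, hc⟩ := hsel _ hinj rfl
  refine ⟨c, ?_⟩
  ext i
  by_cases hi : (i : ℕ) < 3 ∨ N - 6 ≤ (i : ℕ)
  · obtain ⟨k, rfl⟩ := mem_range_endpoints hN hi
    exact congrFun hc k
  have hrange : ∀ k, endpoints hN k ≠ i := fun k hk => hi (by rw [← hk]; exact endpoints_val hN k)
  push Not at hi
  have key : ∀ k : Fin 9, k ≠ 0 → d i = d (endpoints hN k) → p i = c * d i := by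
    intro k hk hik
    -- use `i` in place of the end index `k`; the index `0` is kept and fixes the multiple
    obtain ⟨c', hc'⟩ := hsel (Function.update (endpoints hN) k i)
      (by
        intro a b hab
        rcases eq_or_ne a k with ha | ha <;> rcases eq_or_ne b k with hb | hb
        · exact ha.trans hb.symm
        · rw [ha, Function.update_self, Function.update_of_ne hb] at hab
          exact absurd hab.symm (hrange b)
        · rw [hb, Function.update_self, Function.update_of_ne ha] at hab
          exact absurd hab (hrange a)
        · rw [Function.update_of_ne ha, Function.update_of_ne hb] at hab
          exact hinj hab)
      (by
        ext a
        rcases eq_or_ne a k with rfl | ha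
        · simp [hik]
        · simp [Function.update_of_ne ha])
    have e0 := congrFun hc 0
    have e0' := congrFun hc' 0
    have ek := congrFun hc' k
    simp only [Function.comp_apply, Pi.smul_apply, smul_eq_mul, Function.update_self,
      Function.update_of_ne hk.symm] at e0 e0' ek
    rw [e0] at e0'
    rw [ek, hik, mul_right_cancel₀ hne e0']
  rcases hmid i hi.1 hi.2 with h2 | h3
  · exact key 2 (by decide) h2
  · exact key 3 (by decide) h3

end ExtremeRays

/-! ### Schmidt decomposition and Birkhoff weights -/

section Matrices

open Matrix

/-- Diagonalize `X Xᴴ` for the coefficient matrix `X` of `ψ`: in the eigenbasis the rows of `X` are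
orthogonal, so up to norms they extend to an orthonormal basis. -/
theorem exists_schmidt_decomposition {m n : ℕ} (h : m ≤ n) (ψ : Fin m × Fin n → ℂ) :
    ∃ V ∈ unitaryGroup (Fin m) ℂ, ∃ Y ∈ unitaryGroup (Fin n) ℂ, ∃ s : Fin m → ℝ,
      ∀ a b, ψ (a, b) = ∑ i, (s i : ℂ) * V a i * Y b (Fin.castLE h i) := by
  set X : Matrix (Fin m) (Fin n) ℂ := Matrix.of fun a b => ψ (a, b) with hX
  have hG : (X * Xᴴ).IsHermitian := isHermitian_mul_conjTranspose_self X
  set V : Matrix (Fin m) (Fin m) ℂ := hG.eigenvectorUnitary.1 with hV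
  have hVmem : V ∈ unitaryGroup (Fin m) ℂ := hG.eigenvectorUnitary.2
  set Z := Vᴴ * X with hZ
  have hdiag : Z * Zᴴ = diagonal (RCLike.ofReal ∘ hG.eigenvalues) := by
    rw [← hG.conjStarAlgAut_star_eigenvectorUnitary, Unitary.conjStarAlgAut_star_apply]
    simp only [hZ, conjTranspose_mul, conjTranspose_conjTranspose, Matrix.mul_assoc,
      star_eq_conjTranspose, ← hV]
  set f : Fin n → EuclideanSpace ℂ (Fin n) := fun j =>
    if hj : (j : ℕ) < m then WithLp.toLp 2 (fun b => Z ⟨j, hj⟩ b) else 0 with hf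
  have hfι : ∀ i : Fin m, f (Fin.castLE h i) = WithLp.toLp 2 (fun b => Z i b) := by
    intro i
    simp [hf]
  have horth : Pairwise fun i j => inner ℂ (f i) (f j) = 0 := by
    intro i j hij
    simp only [hf]
    split_ifs with hi hj
    · have h1 := congrFun (congrFun hdiag ⟨j, hj⟩) ⟨i, hi⟩
      rw [diagonal_apply_ne _ (by simpa [Fin.ext_iff] using Ne.symm hij)] at h1
      rw [← h1]
      simp [PiLp.inner_apply, Matrix.mul_apply]
    all_goals simp
  set B := InnerProductSpace.gramSchmidtOrthonormalBasis (𝕜 := ℂ)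
    (by simp : Module.finrank ℂ (EuclideanSpace ℂ (Fin n)) = Fintype.card (Fin n)) f with hB
  have hfB : ∀ j, f j = (‖f j‖ : ℂ) • B j := by
    intro j
    rcases eq_or_ne (f j) 0 with h0 | h0
    · simp [h0]
    · have h1 : (‖f j‖ : ℂ) ≠ 0 := by simpa using h0
      rw [hB, InnerProductSpace.gramSchmidtOrthonormalBasis_apply_of_orthogonal _ horth h0,
        smul_smul]
      erw [mul_inv_cancel₀ h1]
      rw [one_smul]
  refine ⟨V, hVmem, (EuclideanSpace.basisFun (Fin n) ℂ).toBasis.toMatrix B,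
    (EuclideanSpace.basisFun (Fin n) ℂ).toMatrix_orthonormalBasis_mem_unitary B,
    fun i => ‖f (Fin.castLE h i)‖, fun a b => ?_⟩
  have h1 : X = V * Z := by
    rw [hZ, ← Matrix.mul_assoc, ← star_eq_conjTranspose, mem_unitaryGroup_iff.1 hVmem,
      Matrix.one_mul]
  have h2 : ψ (a, b) = (V * Z) a b := by rw [← h1]; rfl
  rw [h2, Matrix.mul_apply]
  refine Finset.sum_congr rfl fun i _ => ?_
  have h3 : Z i b = f (Fin.castLE h i) b := by rw [hfι]
  have h4 : f (Fin.castLE h i) b = (‖f (Fin.castLE h i)‖ : ℂ) * B (Fin.castLE h i) b := by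
    conv_lhs => rw [hfB]
    rfl
  rw [h3, h4]
  simp [Module.Basis.toMatrix_apply]
  ring

/-- The squared moduli of a unitary matrix are a mixture of permutation matrices. -/
theorem exists_perm_weights_of_unitary {ι : Type*} [Fintype ι] [DecidableEq ι] {X : Matrix ι ι ℂ}
    (hX : X ∈ unitaryGroup ι ℂ) : ∃ w : Equiv.Perm ι → ℝ, (∀ σ, 0 ≤ w σ) ∧ ∑ σ, w σ = 1 ∧
      ∀ d : ι → ℝ, (fun p => ∑ q, ‖X p q‖ ^ 2 * d q) = ∑ σ, w σ • (d ∘ σ) := by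
  have hS : (Matrix.of fun p q => ‖X p q‖ ^ 2) ∈ doublyStochastic ℝ ι := by
    rw [mem_doublyStochastic_iff_sum]
    refine ⟨fun i j => by simp only [of_apply]; positivity, fun i => ?_, fun j => ?_⟩
    · have := congrFun (congrFun (mem_unitaryGroup_iff.1 hX) i) i
      simp only [Matrix.mul_apply, star_apply, one_apply_eq, RCLike.star_def,
        Complex.mul_conj'] at this
      simp only [of_apply]
      exact_mod_cast this
    · have := congrFun (congrFun (mem_unitaryGroup_iff'.1 hX) j) j
      simp only [Matrix.mul_apply, star_apply, one_apply_eq, RCLike.star_def,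
        Complex.conj_mul'] at this
      simp only [of_apply]
      exact_mod_cast this
  obtain ⟨w, hw, hw1, hw2⟩ := exists_eq_sum_perm_of_mem_doublyStochastic hS
  refine ⟨w, hw, hw1, fun d => ?_⟩
  ext p
  have h : ∀ q, ‖X p q‖ ^ 2 = ∑ σ : Equiv.Perm ι, w σ * (if σ p = q then 1 else 0) := by
    intro q
    have := congrFun (congrFun hw2 p) q
    simp only [of_apply] at this
    rw [← this, Matrix.sum_apply]
    refine Finset.sum_congr rfl fun σ _ => ?_
    simp [Equiv.Perm.permMatrix, PEquiv.toMatrix_apply, Equiv.toPEquiv_apply, eq_comm]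
  simp only [h, Finset.sum_mul, Finset.sum_apply, Pi.smul_apply, Function.comp_apply, smul_eq_mul]
  rw [Finset.sum_comm]
  refine Finset.sum_congr rfl fun σ _ => ?_
  simp

/-- The complex diagonal matrix with real diagonal `d`. -/
def realDiagonal {ι : Type*} [DecidableEq ι] (d : ι → ℝ) : Matrix ι ι ℂ :=
  diagonal fun p => (d p : ℂ)

theorem conj_realDiagonal_apply_self {ι : Type*} [Fintype ι] [DecidableEq ι] (X : Matrix ι ι ℂ)
    (d : ι → ℝ) (p : ι) : (X * realDiagonal d * Xᴴ) p p =
      ((∑ q, ‖X p q‖ ^ 2 * d q : ℝ) : ℂ) := by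
  rw [Matrix.mul_apply]
  push_cast
  refine Finset.sum_congr rfl fun q _ => ?_
  rw [realDiagonal, mul_diagonal, conjTranspose_apply, RCLike.star_def, ← Complex.mul_conj']
  ring

theorem weighted_perm_mem_pptCone {ι : Type*} [Fintype ι] [DecidableEq ι] {d : ι → ℝ}
    (hd : d ∈ pptCone ι) {X : Matrix ι ι ℂ} (hX : X ∈ unitaryGroup ι ℂ) :
    (fun p => ∑ q, ‖X p q‖ ^ 2 * d q) ∈ pptCone ι := by
  obtain ⟨w, hw, -, hw2⟩ := exists_perm_weights_of_unitary hX
  rw [hw2]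
  refine Finset.sum_induction _ (· ∈ pptCone ι) (fun _ _ => add_mem_pptCone)
    (fun f _ s => by simp [pairForm])
    fun σ _ => smul_mem_pptCone (hw σ) (comp_mem_pptCone hd σ.injective)

/-! ### The partial transpose on vectors in Schmidt form -/

/-- The basis vectors of `ℂ³ ⊗ ℂⁿ` lying in `ℂ³ ⊗ ℂ³`. -/
def pairIndex {n : ℕ} (h : 3 ≤ n) (c : Fin 3 × Fin 3) : Fin 3 × Fin n := (c.1, Fin.castLE h c.2)

theorem pairIndex_injective {n : ℕ} (h : 3 ≤ n) : Function.Injective (pairIndex h) := by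
  rintro ⟨a, b⟩ ⟨c, d⟩ hab
  simpa [pairIndex] using hab

theorem dotProduct_partialTranspose {m n : ℕ} (A : Matrix (Fin m × Fin n) (Fin m × Fin n) ℂ)
    (ψ : Fin m × Fin n → ℂ) : star ψ ⬝ᵥ (partialTranspose A *ᵥ ψ) =
      ∑ p, ∑ q, star (ψ p) * A (p.1, q.2) (q.1, p.2) * ψ q := by
  simp only [dotProduct, mulVec, partialTranspose, of_apply, Finset.mul_sum, Pi.star_apply,
    mul_assoc]

/-- The form of a partial transpose at a Schmidt-decomposed vector is, after the local unitary
`V ⊗ Ȳ`, a sum over the entries of `A` between `eᵢ ⊗ eⱼ` and `eⱼ ⊗ eᵢ`. -/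
theorem sum_schmidt {n : ℕ} (h : 3 ≤ n) (A : Matrix (Fin 3 × Fin n) (Fin 3 × Fin n) ℂ)
    (V : Matrix (Fin 3) (Fin 3) ℂ) (Y : Matrix (Fin n) (Fin n) ℂ) (s : Fin 3 → ℝ)
    {ψ : Fin 3 × Fin n → ℂ}
    (hψ : ∀ a b, ψ (a, b) = ∑ i, (s i : ℂ) * V a i * Y b (Fin.castLE h i)) :
    star ψ ⬝ᵥ (partialTranspose A *ᵥ ψ) =
      ∑ c : Fin 3 × Fin 3, (s c.1 * s c.2 : ℂ) *
        ((kroneckerMap (· * ·) V (Y.map star))ᴴ * A * kroneckerMap (· * ·) V (Y.map star))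
          (pairIndex h c) (pairIndex h c.swap) := by
  set T := kroneckerMap (· * ·) V (Y.map star) with hT
  -- the partial transposition exchanges the second components of row and column index
  let r : (Fin 3 × Fin n) × (Fin 3 × Fin n) ≃ (Fin 3 × Fin n) × (Fin 3 × Fin n) :=
    { toFun := fun x => ((x.1.1, x.2.2), (x.2.1, x.1.2))
      invFun := fun x => ((x.1.1, x.2.2), (x.2.1, x.1.2))
      left_inv := fun _ => rfl
      right_inv := fun _ => rfl }
  have hR : ∀ c : Fin 3 × Fin 3, (Tᴴ * A * T) (pairIndex h c) (pairIndex h c.swap) =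
      ∑ x : (Fin 3 × Fin n) × (Fin 3 × Fin n), star (V x.1.1 c.1 * Y x.1.2 (Fin.castLE h c.1)) *
        A (x.1.1, x.2.2) (x.2.1, x.1.2) * (V x.2.1 c.2 * Y x.2.2 (Fin.castLE h c.2)) := by
    intro c
    simp only [Matrix.mul_apply, Finset.sum_mul]
    rw [Finset.sum_comm, ← Fintype.sum_prod_type']
    refine Fintype.sum_equiv r _ _ fun x => ?_
    simp only [r, Equiv.coe_fn_mk, hT, conjTranspose_apply, kroneckerMap_apply, map_apply,
      pairIndex, Prod.fst_swap, Prod.snd_swap, star_mul', star_star]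
    ring
  simp only [hR]
  have hψ' : ∀ p, ψ p = ∑ i, (s i : ℂ) * V p.1 i * Y p.2 (Fin.castLE h i) := fun p => hψ p.1 p.2
  rw [dotProduct_partialTranspose, ← Fintype.sum_prod_type']
  simp only [Finset.mul_sum]
  rw [Finset.sum_comm]
  refine Finset.sum_congr rfl fun x _ => ?_
  rw [hψ', hψ', star_sum, Finset.sum_mul, Finset.sum_mul, Fintype.sum_prod_type]
  refine Finset.sum_congr rfl fun i _ => ?_
  rw [Finset.mul_sum]
  refine Finset.sum_congr rfl fun k _ => ?_
  simp only [star_mul', RCLike.star_def, Complex.conj_ofReal]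
  ring

/-! ### Eigenvectors of a partially transposed Schmidt vector -/

variable {n : ℕ}

/-- The exchange of tensor factors on `ℂ³ ⊗ ℂ³`, and the identity on the other basis vectors. -/
def exchange (h : 3 ≤ n) (p : Fin 3 × Fin n) : Fin 3 × Fin n :=
  if hp : (p.2 : ℕ) < 3 then (⟨p.2, hp⟩, Fin.castLE h p.1) else p

theorem exchange_exchange (h : 3 ≤ n) (p : Fin 3 × Fin n) : exchange h (exchange h p) = p := by
  by_cases hp : (p.2 : ℕ) < 3
  · simp [exchange, hp]
  · simp [exchange, hp]

theorem exchange_pairIndex (h : 3 ≤ n) (c : Fin 3 × Fin 3) :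
    exchange h (pairIndex h c) = pairIndex h c.swap := by
  simp [exchange, pairIndex]

/-- The diagonal entries of `bellRotation`. -/
noncomputable def rotDiag (h : 3 ≤ n) (p : Fin 3 × Fin n) : ℂ :=
  if exchange h p = p then 1 else
    (if (p.1 : ℕ) ≤ p.2 then 1 else -1) * ((Real.sqrt 2)⁻¹ : ℝ)

/-- The entries of `bellRotation` between a basis vector and its exchange. -/
noncomputable def rotOff (h : 3 ≤ n) (p : Fin 3 × Fin n) : ℂ :=
  if exchange h p = p then 0 else ((Real.sqrt 2)⁻¹ : ℝ)

/-- The unitary matrix fixing the basis vectors fixed by `exchange` and sending the others to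
`(eᵢ ⊗ eⱼ + eⱼ ⊗ eᵢ) / √2` (the image of `eᵢ ⊗ eⱼ`, `i < j`) and `(eᵢ ⊗ eⱼ - eⱼ ⊗ eᵢ) / √2`
(the image of `eⱼ ⊗ eᵢ`). -/
noncomputable def bellRotation (h : 3 ≤ n) : Matrix (Fin 3 × Fin n) (Fin 3 × Fin n) ℂ :=
  Matrix.of fun p q => rotDiag h p * (if p = q then 1 else 0) +
    rotOff h p * (if exchange h p = q then 1 else 0)

theorem bellRotation_conj_apply (h : 3 ≤ n) (B : Matrix (Fin 3 × Fin n) (Fin 3 × Fin n) ℂ)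
    (p q : Fin 3 × Fin n) : (bellRotation h * B * (bellRotation h)ᴴ) p q =
      rotDiag h p * rotDiag h q * B p q + rotDiag h p * rotOff h q * B p (exchange h q) +
      rotOff h p * rotDiag h q * B (exchange h p) q +
      rotOff h p * rotOff h q * B (exchange h p) (exchange h q) := by
  have h1 : ∀ q, star (rotDiag h q) = rotDiag h q := by
    intro q
    simp only [rotDiag]
    split_ifs <;> simp
  have h2 : ∀ q, star (rotOff h q) = rotOff h q := by
    intro q
    simp only [rotOff]
    split_ifs <;> simp
  have hL : ∀ r, (bellRotation h * B) p r =
      rotDiag h p * B p r + rotOff h p * B (exchange h p) r := by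
    intro r
    simp [Matrix.mul_apply, bellRotation, add_mul, Finset.sum_add_distrib]
  have hR : ∀ r, (bellRotation h)ᴴ r q = rotDiag h q * (if q = r then 1 else 0) +
      rotOff h q * (if exchange h q = r then 1 else 0) := by
    intro r
    simp only [conjTranspose_apply, bellRotation, of_apply, star_add, star_mul', h1, h2,
      apply_ite star, star_one, star_zero]
  rw [Matrix.mul_apply]
  simp only [hL, hR, mul_add, Finset.sum_add_distrib]
  simp
  ring

theorem inv_sqrt_two_mul_self :
    (((Real.sqrt 2)⁻¹ : ℝ) : ℂ) * (((Real.sqrt 2)⁻¹ : ℝ) : ℂ) = 1 / 2 := by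
  rw [← Complex.ofReal_mul, ← mul_inv, Real.mul_self_sqrt (by norm_num)]
  norm_num

theorem exchange_sign (h : 3 ≤ n) {p : Fin 3 × Fin n} (hp : exchange h p ≠ p) :
    ((if ((exchange h p).1 : ℕ) ≤ (exchange h p).2 then 1 else -1 : ℂ)) =
      -(if (p.1 : ℕ) ≤ p.2 then 1 else -1) := by
  have hlt : (p.2 : ℕ) < 3 := by
    by_contra hc
    exact hp (by simp [exchange, hc])
  have hne : (p.1 : ℕ) ≠ p.2 := by
    intro he
    apply hp
    simp only [exchange, hlt, dif_pos]
    ext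
    · simp [he]
    · simp [he]
  simp only [exchange, hlt, dif_pos, Fin.val_castLE]
  rcases lt_or_gt_of_ne hne with h1 | h1
  · rw [if_neg (by omega), if_pos (by omega)]
  · rw [if_pos (by omega), if_neg (by omega), neg_neg]

theorem rotDiag_exchange (h : 3 ≤ n) {p : Fin 3 × Fin n} (hp : exchange h p ≠ p) :
    rotDiag h (exchange h p) = -rotDiag h p := by
  have hp' : exchange h (exchange h p) ≠ exchange h p := by
    rw [exchange_exchange]; exact hp.symm
  rw [rotDiag, rotDiag, if_neg hp', if_neg hp, exchange_sign h hp, neg_mul]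

theorem rotOff_exchange (h : 3 ≤ n) (p : Fin 3 × Fin n) :
    rotOff h (exchange h p) = rotOff h p := by
  rw [rotOff, rotOff, exchange_exchange]
  simp only [eq_comm]

theorem bellRotation_mem_unitaryGroup (h : 3 ≤ n) :
    bellRotation h ∈ unitaryGroup (Fin 3 × Fin n) ℂ := by
  rw [mem_unitaryGroup_iff, star_eq_conjTranspose]
  ext p q
  have := bellRotation_conj_apply h 1 p q
  rw [Matrix.mul_one] at this
  rw [this]
  by_cases hp : exchange h p = p
  · have hoff : rotOff h p = 0 := by simp [rotOff, hp]
    have hdp : rotDiag h p = 1 := by simp [rotDiag, hp]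
    rw [hoff, hdp]
    by_cases hq : exchange h q = q
    · have hoff : rotOff h q = 0 := by simp [rotOff, hq]
      have hdp : rotDiag h q = 1 := by simp [rotDiag, hq]
      simp [hoff, hdp]
    · have hne : p ≠ q := by rintro rfl; exact hq hp
      have hne' : p ≠ exchange h q := by
        rintro rfl
        rw [exchange_exchange] at hp
        exact hq hp.symm
      simp [one_apply_ne hne, one_apply_ne hne']
  · by_cases hpq : p = q
    · subst hpq
      rw [one_apply_eq, one_apply_eq, one_apply_ne hp, one_apply_ne (Ne.symm hp)]
      simp only [rotDiag, rotOff, if_neg hp]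
      have := inv_sqrt_two_mul_self
      split_ifs
      · linear_combination 2 * this
      · linear_combination 2 * this
    · by_cases hpq' : exchange h p = q
      · subst hpq'
        rw [exchange_exchange, rotDiag_exchange h hp, rotOff_exchange, one_apply_eq,
          one_apply_eq, one_apply_ne hpq, one_apply_ne hp]
        ring
      · have h1 : p ≠ exchange h q := by
          rintro rfl
          rw [exchange_exchange] at hpq'
          exact hpq' rfl
        have h2 : exchange h p ≠ exchange h q := by
          intro he
          apply hpq
          rw [← exchange_exchange h p, he, exchange_exchange]
        simp [one_apply_ne hpq, one_apply_ne hpq', one_apply_ne h1, one_apply_ne h2]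

/-- `bellRotation` turns the exchange form into the signed diagonal form. -/
theorem sum_bellRotation (h : 3 ≤ n) (B : Matrix (Fin 3 × Fin n) (Fin 3 × Fin n) ℂ)
    (s : Fin 3 → ℝ) :
    ∑ c : Fin 3 × Fin 3, (s c.1 * s c.2 : ℂ) *
        (bellRotation h * B * (bellRotation h)ᴴ) (pairIndex h c) (pairIndex h c.swap) =
      ∑ c : Fin 3 × Fin 3, (pairSign c : ℂ) * (s c.1 * s c.2) *
        B (pairIndex h c) (pairIndex h c) := by
  rw [← sub_eq_zero, ← Finset.sum_sub_distrib]
  set Z : Fin 3 × Fin 3 → ℂ := fun c => (s c.1 * s c.2 : ℂ) *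
        (bellRotation h * B * (bellRotation h)ᴴ) (pairIndex h c) (pairIndex h c.swap) -
      (pairSign c : ℂ) * (s c.1 * s c.2) * B (pairIndex h c) (pairIndex h c) with hZ
  -- the two sides agree only after summing over `(i, j)` and `(j, i)`
  have hanti : ∀ c, Z c.swap = -Z c := by
    rintro ⟨i, k⟩
    simp only [hZ, bellRotation_conj_apply, Prod.swap_swap, exchange_pairIndex, Prod.fst_swap,
      Prod.snd_swap]
    rcases eq_or_ne i k with rfl | hik
    · have hfix : exchange h (pairIndex h (i, i)) = pairIndex h (i, i) := exchange_pairIndex h _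
      simp [rotDiag, rotOff, hfix, pairSign]
    · have hne : exchange h (pairIndex h (i, k)) ≠ pairIndex h (i, k) := by
        rw [exchange_pairIndex]
        exact fun he => hik (congrArg Prod.snd (pairIndex_injective h he))
      have h1 := rotDiag_exchange h hne
      have h2 := rotOff_exchange h (pairIndex h (i, k))
      rw [exchange_pairIndex] at h1 h2
      rw [h1, h2]
      have h3 : rotDiag h (pairIndex h (i, k)) * rotOff h (pairIndex h (i, k)) =
          pairSign (i, k) * (1 / 2) := by
        rw [rotDiag, rotOff, if_neg hne, if_neg hne, mul_assoc, inv_sqrt_two_mul_self]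
        simp only [pairIndex, pairSign, Fin.val_castLE, Fin.le_def]
        by_cases h5 : (i : ℕ) ≤ k <;> simp only [h5, if_true, if_false] <;> push_cast <;> ring
      have h4 : (pairSign (Prod.swap (i, k)) : ℂ) = -pairSign (i, k) := by
        simp only [pairSign, Prod.fst_swap, Prod.snd_swap]
        rcases lt_or_gt_of_ne hik with h5 | h5
        · rw [if_pos h5.le, if_neg (not_le.2 h5)]; simp
        · rw [if_pos h5.le, if_neg (not_le.2 h5)]; simp
      have h5 : rotDiag h (pairIndex h (i, k)) * rotDiag h (pairIndex h (i, k)) = 1 / 2 := by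
        rw [rotDiag, if_neg hne, ← inv_sqrt_two_mul_self]
        split_ifs <;> ring
      have h6 : rotOff h (pairIndex h (i, k)) * rotOff h (pairIndex h (i, k)) = 1 / 2 := by
        rw [rotOff, if_neg hne, ← inv_sqrt_two_mul_self]
      rw [h4]
      linear_combination (s i * s k : ℂ) * (-(h5 - h6) *
        (B (pairIndex h (i, k).swap) (pairIndex h (i, k)) +
          B (pairIndex h (i, k)) (pairIndex h (i, k).swap)) +
        2 * h3 * (B (pairIndex h (i, k)) (pairIndex h (i, k)) -
          B (pairIndex h (i, k).swap) (pairIndex h (i, k).swap)))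
  have : ∑ c, Z c = -∑ c, Z c := by
    conv_lhs => rw [← Equiv.sum_comp (Equiv.prodComm _ _)]
    rw [← Finset.sum_neg_distrib]
    exact Finset.sum_congr rfl fun c _ => hanti c
  exact self_eq_neg.1 this

end Matrices

/-! ### Absolutely PPT states and their spectra -/

section AbsolutelyPPT

open Matrix

variable {n : ℕ}

theorem realDiagonal_isHermitian {ι : Type*} [DecidableEq ι] (d : ι → ℝ) :
    (realDiagonal d).IsHermitian := by
  rw [realDiagonal, isHermitian_diagonal_iff]
  intro p
  exact Complex.conj_ofReal _

theorem partialTranspose_isHermitian {m n : ℕ}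
    {A : Matrix (Fin m × Fin n) (Fin m × Fin n) ℂ} (hA : A.IsHermitian) :
    (partialTranspose A).IsHermitian := by
  ext p q
  simp only [conjTranspose_apply, partialTranspose, of_apply]
  exact hA.apply _ _

theorem sum_pairSign_eq_pairForm (h : 3 ≤ n) (b : Fin 3 × Fin n → ℝ) (s : Fin 3 → ℝ)
    {B : Matrix (Fin 3 × Fin n) (Fin 3 × Fin n) ℂ} (hB : ∀ p, B p p = (b p : ℂ)) :
    ∑ c : Fin 3 × Fin 3, (pairSign c : ℂ) * (s c.1 * s c.2) *
      B (pairIndex h c) (pairIndex h c) = (pairForm (pairIndex h) b s : ℂ) := by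
  simp only [pairForm, hB]
  push_cast
  rfl

/-- Test on a vector in Schmidt form, after permuting the eigenvalues as `f` prescribes and applying
`bellRotation`. -/
theorem mem_pptCone_of_partialTranspose_posSemidef (h : 3 ≤ n) {d : Fin 3 × Fin n → ℝ}
    (hd : ∀ U ∈ unitaryGroup (Fin 3 × Fin n) ℂ,
      (partialTranspose (U * realDiagonal d * Uᴴ)).PosSemidef) :
    d ∈ pptCone (Fin 3 × Fin n) := by
  intro f hf s
  obtain ⟨π, hπ⟩ := Equiv.Perm.exists_extending_pair _ _ (pairIndex_injective h) hf
  set P : Matrix (Fin 3 × Fin n) (Fin 3 × Fin n) ℂ :=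
    (1 : Matrix (Fin 3 × Fin n) (Fin 3 × Fin n) ℂ).submatrix π id with hP
  have hPmem : P ∈ unitaryGroup (Fin 3 × Fin n) ℂ := by
    rw [mem_unitaryGroup_iff, star_eq_conjTranspose, hP, conjTranspose_submatrix,
      conjTranspose_one, ← submatrix_mul _ _ _ _ _ Function.bijective_id, Matrix.mul_one,
      submatrix_one_equiv]
  have hB : ∀ p, (P * realDiagonal d * Pᴴ) p p = ((d ∘ π) p : ℂ) := by
    intro p
    have h1 : P * realDiagonal d * Pᴴ = (realDiagonal d).submatrix π π := by
      have h2 : realDiagonal d = (realDiagonal d).submatrix id id := (submatrix_id_id _).symm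
      rw [hP, conjTranspose_submatrix, conjTranspose_one]
      conv_lhs => rw [h2]
      rw [← submatrix_mul _ _ _ _ _ Function.bijective_id,
        ← submatrix_mul _ _ _ _ _ Function.bijective_id, Matrix.one_mul, Matrix.mul_one]
    rw [h1, submatrix_apply, realDiagonal, diagonal_apply_eq]
    rfl
  have h1 := hd _ (mul_mem (bellRotation_mem_unitaryGroup h) hPmem)
  set ψ : Fin 3 × Fin n → ℂ := fun p => ∑ i, (s i : ℂ) * (1 : Matrix (Fin 3) (Fin 3) ℂ) p.1 i *
    (1 : Matrix (Fin n) (Fin n) ℂ) p.2 (Fin.castLE h i) with hψ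
  have h2 := h1.dotProduct_mulVec_nonneg ψ
  have h3 : kroneckerMap (· * ·) (1 : Matrix (Fin 3) (Fin 3) ℂ)
      ((1 : Matrix (Fin n) (Fin n) ℂ).map star) = 1 := by
    rw [Matrix.map_one _ (star_zero _) (star_one _)]
    exact one_kronecker_one
  rw [sum_schmidt h _ 1 1 s (fun a b => rfl), h3, conjTranspose_one, Matrix.one_mul,
    Matrix.mul_one, conjTranspose_mul, ← Matrix.mul_assoc, Matrix.mul_assoc (bellRotation h),
    Matrix.mul_assoc (bellRotation h), sum_bellRotation, sum_pairSign_eq_pairForm h _ s hB] at h2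
  have h4 : pairForm f d s = pairForm (pairIndex h) (d ∘ π) s :=
    Finset.sum_congr rfl fun c _ => by simp only [Function.comp_apply, hπ]
  rw [h4]
  exact_mod_cast h2

/-- After a Schmidt decomposition of the test vector the form is a pair form of the diagonal of a
unitary conjugate of `d`, which by Birkhoff's theorem is a mixture of permutations of `d`. -/
theorem partialTranspose_posSemidef_of_mem_pptCone (h : 3 ≤ n) {d : Fin 3 × Fin n → ℝ}
    (hd : d ∈ pptCone (Fin 3 × Fin n)) {U : Matrix (Fin 3 × Fin n) (Fin 3 × Fin n) ℂ}
    (hU : U ∈ unitaryGroup (Fin 3 × Fin n) ℂ) :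
    (partialTranspose (U * realDiagonal d * Uᴴ)).PosSemidef := by
  refine PosSemidef.of_dotProduct_mulVec_nonneg (partialTranspose_isHermitian
    (isHermitian_mul_mul_conjTranspose U (realDiagonal_isHermitian d))) fun ψ => ?_
  obtain ⟨V, hV, Y, hY, s, hψ⟩ := exists_schmidt_decomposition h ψ
  rw [sum_schmidt h _ V Y s hψ]
  set T := kroneckerMap (· * ·) V (Y.map star) with hT
  have hTmem : T ∈ unitaryGroup (Fin 3 × Fin n) ℂ :=
    kronecker_mem_unitary hV (map_star_mem_unitaryGroup_iff.2 hY)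
  set W := bellRotation h
  have hW : W * Wᴴ = 1 := mem_unitaryGroup_iff.1 (bellRotation_mem_unitaryGroup h)
  set X := Wᴴ * Tᴴ * U with hX
  have hXmem : X ∈ unitaryGroup (Fin 3 × Fin n) ℂ :=
    mul_mem (mul_mem (Unitary.star_mem (bellRotation_mem_unitaryGroup h))
      (Unitary.star_mem hTmem)) hU
  have key : Tᴴ * (U * realDiagonal d * Uᴴ) * T = W * (X * realDiagonal d * Xᴴ) * Wᴴ := by
    have h1 : W * X = Tᴴ * U := by
      rw [hX, Matrix.mul_assoc, ← Matrix.mul_assoc W, hW, Matrix.one_mul]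
    calc Tᴴ * (U * realDiagonal d * Uᴴ) * T = (Tᴴ * U) * realDiagonal d * (Tᴴ * U)ᴴ := by
          simp only [conjTranspose_mul, conjTranspose_conjTranspose, Matrix.mul_assoc]
      _ = W * (X * realDiagonal d * Xᴴ) * Wᴴ := by
          rw [← h1]
          simp only [conjTranspose_mul, Matrix.mul_assoc]
  rw [key, sum_bellRotation, sum_pairSign_eq_pairForm h _ s (conj_realDiagonal_apply_self X d)]
  exact_mod_cast weighted_perm_mem_pptCone hd hXmem _ (pairIndex_injective h) s

theorem conj_mem_absolutelyPPT {m n : ℕ} {A U : Matrix (Fin m × Fin n) (Fin m × Fin n) ℂ}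
    (hA : A ∈ absolutelyPPT m n) (hU : U ∈ unitaryGroup (Fin m × Fin n) ℂ) :
    U * A * Uᴴ ∈ absolutelyPPT m n := by
  refine ⟨⟨hA.1.1.mul_mul_conjTranspose_same U, ?_⟩, fun V hV => ?_⟩
  · rw [Matrix.mul_assoc, trace_mul_comm, Matrix.mul_assoc, ← star_eq_conjTranspose,
      mem_unitaryGroup_iff'.1 hU, Matrix.mul_one, hA.1.2]
  · have := hA.2 (V * U) (mul_mem hV hU)
    rwa [conjTranspose_mul, ← Matrix.mul_assoc, Matrix.mul_assoc V, Matrix.mul_assoc V] at this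

theorem nine_le_card (h : 3 ≤ n) : 9 ≤ Fintype.card (Fin 3 × Fin n) := by
  simp; omega

theorem trace_realDiagonal {ι : Type*} [Fintype ι] [DecidableEq ι] (d : ι → ℝ) :
    (realDiagonal d).trace = ((∑ p, d p : ℝ) : ℂ) := by
  rw [realDiagonal, trace_diagonal]
  push_cast
  rfl

theorem realDiagonal_mem_absolutelyPPT_iff (h : 3 ≤ n) {d : Fin 3 × Fin n → ℝ} :
    realDiagonal d ∈ absolutelyPPT 3 n ↔ d ∈ pptCone (Fin 3 × Fin n) ∧ ∑ p, d p = 1 := by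
  constructor
  · rintro ⟨⟨-, h2⟩, h3⟩
    refine ⟨mem_pptCone_of_partialTranspose_posSemidef h h3, ?_⟩
    rw [trace_realDiagonal] at h2
    exact_mod_cast h2
  · rintro ⟨h1, h2⟩
    refine ⟨⟨posSemidef_diagonal_iff.2 fun p => ?_, ?_⟩, fun U hU =>
      partialTranspose_posSemidef_of_mem_pptCone h h1 hU⟩
    · exact_mod_cast pptCone_nonneg (nine_le_card h) h1 p
    · rw [trace_realDiagonal, h2, Complex.ofReal_one]

theorem eq_conj_realDiagonal_eigenvalues {ι : Type*} [Fintype ι] [DecidableEq ι]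
    {A : Matrix ι ι ℂ} (hA : A.IsHermitian) :
    A = hA.eigenvectorUnitary.1 * realDiagonal hA.eigenvalues * hA.eigenvectorUnitary.1ᴴ := by
  conv_lhs => rw [hA.spectral_theorem, Unitary.conjStarAlgAut_apply]
  rfl

theorem conj_star_eigenvectorUnitary {ι : Type*} [Fintype ι] [DecidableEq ι]
    {A : Matrix ι ι ℂ} (hA : A.IsHermitian) :
    star hA.eigenvectorUnitary.1 * A * (star hA.eigenvectorUnitary.1)ᴴ =
      realDiagonal hA.eigenvalues := by
  have h := hA.conjStarAlgAut_star_eigenvectorUnitary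
  rw [Unitary.conjStarAlgAut_star_apply] at h
  rw [star_eq_conjTranspose, conjTranspose_conjTranspose, ← star_eq_conjTranspose]
  exact h

theorem realDiagonal_eigenvalues_mem {m : ℕ} {A : Matrix (Fin m × Fin n) (Fin m × Fin n) ℂ}
    (hA : A ∈ absolutelyPPT m n) (hH : A.IsHermitian) :
    realDiagonal hH.eigenvalues ∈ absolutelyPPT m n := by
  have h1 := conj_mem_absolutelyPPT hA (Unitary.star_mem hH.eigenvectorUnitary.2)
  rwa [conj_star_eigenvectorUnitary] at h1

theorem sum_sq_norm_conj_realDiagonal {ι : Type*} [Fintype ι] [DecidableEq ι]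
    {X : Matrix ι ι ℂ} (hX : X ∈ unitaryGroup ι ℂ) (d : ι → ℝ) :
    ∑ p, ∑ q, ‖(X * realDiagonal d * Xᴴ) p q‖ ^ 2 = ∑ p, d p ^ 2 := by
  set A := X * realDiagonal d * Xᴴ with hA
  have h1 : (A * Aᴴ).trace = ((∑ p, ∑ q, ‖A p q‖ ^ 2 : ℝ) : ℂ) := by
    rw [trace]
    push_cast
    refine Finset.sum_congr rfl fun p _ => ?_
    rw [diag_apply, Matrix.mul_apply]
    refine Finset.sum_congr rfl fun q _ => ?_
    rw [conjTranspose_apply, RCLike.star_def, Complex.mul_conj']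
  have hXX : Xᴴ * X = 1 := mem_unitaryGroup_iff'.1 hX
  have h2 : A * Aᴴ = X * realDiagonal (fun p => d p ^ 2) * Xᴴ := by
    have hD : realDiagonal d * realDiagonal d = realDiagonal (fun p => d p ^ 2) := by
      rw [realDiagonal, diagonal_mul_diagonal, realDiagonal]
      congr 1
      ext p
      push_cast
      ring
    have hH : Aᴴ = A := isHermitian_mul_mul_conjTranspose X (realDiagonal_isHermitian d)
    rw [hH, hA, ← hD]
    calc X * realDiagonal d * Xᴴ * (X * realDiagonal d * Xᴴ)
        = X * realDiagonal d * (Xᴴ * X) * realDiagonal d * Xᴴ := by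
          simp only [Matrix.mul_assoc]
      _ = _ := by rw [hXX, Matrix.mul_one]; simp only [Matrix.mul_assoc]
  rw [h2, Matrix.mul_assoc, trace_mul_comm, Matrix.mul_assoc, hXX, Matrix.mul_one,
    trace_realDiagonal] at h1
  exact_mod_cast h1.symm

/-- A unitary conjugate of `l` in the cone with trace one whose diagonal is an extreme ray
`d` is itself diagonal. -/
theorem eq_realDiagonal_of_diag_eq {ι : Type*} [Fintype ι] [DecidableEq ι] {d : ι → ℝ}
    (hd : IsExtremeRay d) (hd1 : ∑ p, d p = 1) {X : Matrix ι ι ℂ} (hX : X ∈ unitaryGroup ι ℂ)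
    {l : ι → ℝ} (hl : l ∈ pptCone ι) (hl1 : ∑ p, l p = 1)
    (hdiag : (fun p => ∑ q, ‖X p q‖ ^ 2 * l q) = d) :
    X * realDiagonal l * Xᴴ = realDiagonal d := by
  obtain ⟨w, hw0, hw1, hw⟩ := exists_perm_weights_of_unitary hX
  have hsum := hw l
  rw [hdiag] at hsum
  -- an extreme ray is not a proper mixture of permutations of `l`
  obtain ⟨σ, hσ⟩ : ∃ σ, w σ ≠ 0 := by
    by_contra hc
    push Not at hc
    simp [hc] at hw1
  have hmem : ∀ τ : Equiv.Perm ι, w τ • (l ∘ τ) ∈ pptCone ι :=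
    fun τ => smul_mem_pptCone (hw0 τ) (comp_mem_pptCone hl τ.injective)
  obtain ⟨c, hc⟩ := hd.2.2 _ (hmem σ) (∑ τ ∈ Finset.univ.erase σ, w τ • (l ∘ τ))
    (Finset.sum_induction _ (· ∈ pptCone ι) (fun _ _ => add_mem_pptCone)
      (fun f _ s => by simp [pairForm]) fun τ _ => hmem τ)
    (by exact (Finset.add_sum_erase _ (fun τ => w τ • (l ∘ τ)) (Finset.mem_univ σ)).trans hsum.symm)
  have hcw : w σ = c := by
    have h1 : ∑ p, (w σ • (l ∘ σ)) p = ∑ p, (c • d) p := by rw [hc]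
    simp only [Pi.smul_apply, smul_eq_mul, ← Finset.mul_sum, Function.comp_apply,
      Equiv.sum_comp σ l, hl1, hd1, mul_one] at h1
    exact h1
  have hlσ : l ∘ σ = d := by
    rw [← hcw] at hc
    exact smul_right_injective _ hσ hc
  -- equality of Hilbert-Schmidt norms kills the off-diagonal entries
  have hnorm := sum_sq_norm_conj_realDiagonal hX l
  have hdd : ∀ p, (X * realDiagonal l * Xᴴ) p p = (d p : ℂ) := by
    intro p
    rw [← hdiag]
    exact conj_realDiagonal_apply_self X l p
  have hl2 : ∑ p, l p ^ 2 = ∑ p, d p ^ 2 := by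
    rw [← hlσ, ← Equiv.sum_comp σ]
    rfl
  set A := X * realDiagonal l * Xᴴ with hA
  have hrow : ∀ p, d p ^ 2 ≤ ∑ q, ‖A p q‖ ^ 2 := by
    intro p
    have := Finset.single_le_sum (f := fun q => ‖A p q‖ ^ 2) (fun q _ => sq_nonneg _)
      (Finset.mem_univ p)
    simpa [hdd] using this
  have hroweq : ∀ p, d p ^ 2 = ∑ q, ‖A p q‖ ^ 2 := by
    have := (Finset.sum_eq_sum_iff_of_le fun p _ => hrow p).1 (by rw [hnorm, hl2])
    exact fun p => this p (Finset.mem_univ p)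
  ext p q
  rcases eq_or_ne p q with rfl | hpq
  · rw [hdd]; simp [realDiagonal]
  · rw [realDiagonal, diagonal_apply_ne _ hpq]
    have h1 := hroweq p
    rw [← Finset.add_sum_erase _ _ (Finset.mem_univ p), hdd] at h1
    have h2 : ∑ q ∈ Finset.univ.erase p, ‖A p q‖ ^ 2 = 0 := by
      simp at h1
      simpa using h1
    have h3 := (Finset.sum_eq_zero_iff_of_nonneg fun q _ => sq_nonneg _).1 h2 q
      (Finset.mem_erase.2 ⟨hpq.symm, Finset.mem_univ q⟩)
    simpa using h3

/-! ### Extreme points -/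

theorem IsExtremeRay.realDiagonal_mem_extremePoints (h : 3 ≤ n) {d : Fin 3 × Fin n → ℝ}
    (hd : IsExtremeRay d) (hd1 : ∑ p, d p = 1) :
    realDiagonal d ∈ Set.extremePoints ℝ (absolutelyPPT 3 n) := by
  rw [mem_extremePoints_iff_left]
  refine ⟨(realDiagonal_mem_absolutelyPPT_iff h).2 ⟨hd.1, hd1⟩, fun A hA B hB hAB => ?_⟩
  obtain ⟨α, β, hα, hβ, hαβ, hsum⟩ := hAB
  have spec : ∀ A ∈ absolutelyPPT 3 n, ∃ X ∈ unitaryGroup (Fin 3 × Fin n) ℂ,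
      ∃ l ∈ pptCone (Fin 3 × Fin n), ∑ p, l p = 1 ∧ A = X * realDiagonal l * Xᴴ := by
    intro A hA
    have hH := absolutelyPPT_isHermitian hA
    have := (realDiagonal_mem_absolutelyPPT_iff h).1 (realDiagonal_eigenvalues_mem hA hH)
    exact ⟨_, hH.eigenvectorUnitary.2, _, this.1, this.2, eq_conj_realDiagonal_eigenvalues hH⟩
  obtain ⟨X, hX, l, hl, hl1, rfl⟩ := spec A hA
  obtain ⟨Y, hY, k, hk, hk1, rfl⟩ := spec B hB
  set a : Fin 3 × Fin n → ℝ := fun p => ∑ q, ‖X p q‖ ^ 2 * l q with ha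
  set b : Fin 3 × Fin n → ℝ := fun p => ∑ q, ‖Y p q‖ ^ 2 * k q with hb
  have hab : α • a + β • b = d := by
    ext p
    have h1 := congrFun (congrFun hsum p) p
    rw [Matrix.add_apply, Matrix.smul_apply, Matrix.smul_apply, conj_realDiagonal_apply_self,
      conj_realDiagonal_apply_self, realDiagonal, diagonal_apply_eq] at h1
    simp only [Complex.real_smul] at h1
    exact_mod_cast h1
  obtain ⟨c, hc⟩ := hd.2.2 _ (smul_mem_pptCone hα.le (weighted_perm_mem_pptCone hl hX)) _
    (smul_mem_pptCone hβ.le (weighted_perm_mem_pptCone hk hY)) hab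
  have hasum : ∑ p, a p = 1 := by
    have h1 : ((∑ p, a p : ℝ) : ℂ) = 1 := by
      rw [← hA.1.2, trace]
      push_cast
      refine Finset.sum_congr rfl fun p _ => ?_
      exact (conj_realDiagonal_apply_self X l p).symm
    exact_mod_cast h1
  have hcα : α = c := by
    have h1 : ∑ p, (α • a) p = ∑ p, (c • d) p := by rw [← hc]
    simp only [Pi.smul_apply, smul_eq_mul, ← Finset.mul_sum, hasum, hd1, mul_one] at h1
    exact h1
  have had : a = d := by
    rw [← hcα] at hc
    exact smul_right_injective _ hα.ne' hc
  exact eq_realDiagonal_of_diag_eq hd hd1 hX hl hl1 had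

theorem sum_pos_of_mem_pptCone (h : 3 ≤ n) {p : Fin 3 × Fin n → ℝ}
    (hp : p ∈ pptCone (Fin 3 × Fin n)) (hp0 : p ≠ 0) : 0 < ∑ i, p i := by
  have h0 := pptCone_nonneg (nine_le_card h) hp
  refine lt_of_le_of_ne (Finset.sum_nonneg fun i _ => h0 i) fun hc => hp0 ?_
  ext i
  exact (Finset.sum_eq_zero_iff_of_nonneg fun i _ => h0 i).1 hc.symm i (Finset.mem_univ i)

theorem realDiagonal_smul {ι : Type*} [DecidableEq ι] (c : ℝ) (d : ι → ℝ) :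
    realDiagonal (c • d) = c • realDiagonal d := by
  rw [realDiagonal, realDiagonal, ← diagonal_smul]
  congr 1
  ext p
  simp

theorem realDiagonal_add {ι : Type*} [DecidableEq ι] (d e : ι → ℝ) :
    realDiagonal (d + e) = realDiagonal d + realDiagonal e := by
  rw [realDiagonal, realDiagonal, realDiagonal, diagonal_add]
  congr 1
  ext p
  simp

theorem realDiagonal_injective {ι : Type*} [DecidableEq ι] :
    Function.Injective (realDiagonal : (ι → ℝ) → Matrix ι ι ℂ) := by
  intro d e hde
  ext p
  have := congrFun (congrFun hde p) p
  simpa [realDiagonal] using this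

theorem isExtremeRay_of_realDiagonal_mem_extremePoints (h : 3 ≤ n) {d : Fin 3 × Fin n → ℝ}
    (hd : realDiagonal d ∈ Set.extremePoints ℝ (absolutelyPPT 3 n)) : IsExtremeRay d := by
  rw [mem_extremePoints_iff_left] at hd
  obtain ⟨hmem, hext⟩ := hd
  obtain ⟨hd0, hd1⟩ := (realDiagonal_mem_absolutelyPPT_iff h).1 hmem
  refine ⟨hd0, ?_, fun p hp q hq hpq => ?_⟩
  · rintro rfl
    simp at hd1
  rcases eq_or_ne p 0 with rfl | hp0
  · exact ⟨0, by simp⟩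
  rcases eq_or_ne q 0 with rfl | hq0
  · exact ⟨1, by simpa using hpq⟩
  have hpp := sum_pos_of_mem_pptCone h hp hp0
  have hqp := sum_pos_of_mem_pptCone h hq hq0
  set P := ∑ i, p i with hP
  set Q := ∑ i, q i with hQ
  have hPQ : P + Q = 1 := by
    rw [hP, hQ, ← Finset.sum_add_distrib, ← hd1, ← hpq]
    rfl
  have norm : ∀ r ∈ pptCone (Fin 3 × Fin n), 0 < ∑ i, r i →
      realDiagonal ((∑ i, r i)⁻¹ • r) ∈ absolutelyPPT 3 n := by
    intro r hr hr0
    refine (realDiagonal_mem_absolutelyPPT_iff h).2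
      ⟨smul_mem_pptCone (inv_nonneg.2 hr0.le) hr, ?_⟩
    simp only [Pi.smul_apply, smul_eq_mul, ← Finset.mul_sum]
    exact inv_mul_cancel₀ hr0.ne'
  have h1 := hext _ (norm p hp hpp) _ (norm q hq hqp) ⟨P, Q, hpp, hqp, hPQ, by
    rw [← realDiagonal_smul, ← realDiagonal_smul, ← realDiagonal_add, smul_smul, smul_smul,
      mul_inv_cancel₀ hpp.ne', mul_inv_cancel₀ hqp.ne', one_smul, one_smul, hpq]⟩
  refine ⟨P, ?_⟩
  rw [← realDiagonal_injective h1, smul_smul, mul_inv_cancel₀ hpp.ne', one_smul]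

theorem conj_mem_extremePoints {m n : ℕ} {A U : Matrix (Fin m × Fin n) (Fin m × Fin n) ℂ}
    (hA : A ∈ Set.extremePoints ℝ (absolutelyPPT m n))
    (hU : U ∈ unitaryGroup (Fin m × Fin n) ℂ) :
    U * A * Uᴴ ∈ Set.extremePoints ℝ (absolutelyPPT m n) := by
  rw [mem_extremePoints_iff_left] at hA ⊢
  have hUU : Uᴴ * U = 1 := mem_unitaryGroup_iff'.1 hU
  have hUU' : U * Uᴴ = 1 := mem_unitaryGroup_iff.1 hU
  refine ⟨conj_mem_absolutelyPPT hA.1 hU, fun B hB C hC hBC => ?_⟩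
  obtain ⟨α, β, hα, hβ, hαβ, hsum⟩ := hBC
  have h1 := hA.2 _ (conj_mem_absolutelyPPT hB (Unitary.star_mem hU)) _
    (conj_mem_absolutelyPPT hC (Unitary.star_mem hU)) ⟨α, β, hα, hβ, hαβ, by
      rw [star_eq_conjTranspose, conjTranspose_conjTranspose]
      calc α • (Uᴴ * B * U) + β • (Uᴴ * C * U) = Uᴴ * (α • B + β • C) * U := by
            simp [Matrix.mul_add, Matrix.add_mul]
        _ = (Uᴴ * U) * A * (Uᴴ * U) := by rw [hsum]; simp only [Matrix.mul_assoc]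
        _ = A := by rw [hUU, Matrix.one_mul, Matrix.mul_one]⟩
  rw [← h1, star_eq_conjTranspose, conjTranspose_conjTranspose]
  calc B = (U * Uᴴ) * B * (U * Uᴴ) := by rw [hUU', Matrix.one_mul, Matrix.mul_one]
    _ = _ := by simp only [Matrix.mul_assoc]

theorem mem_extremePoints_iff_isExtremeRay (h : 3 ≤ n)
    {A : Matrix (Fin 3 × Fin n) (Fin 3 × Fin n) ℂ} (hA : A ∈ absolutelyPPT 3 n) :
    A ∈ Set.extremePoints ℝ (absolutelyPPT 3 n) ↔
      IsExtremeRay (absolutelyPPT_isHermitian hA).eigenvalues₀ := by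
  have hH := absolutelyPPT_isHermitian hA
  change _ ↔ IsExtremeRay hH.eigenvalues₀
  have hspec := eq_conj_realDiagonal_eigenvalues hH
  have hU := hH.eigenvectorUnitary.2
  have hray : IsExtremeRay hH.eigenvalues ↔ IsExtremeRay hH.eigenvalues₀ :=
    isExtremeRay_comp_equiv_iff _
  rw [← hray]
  constructor
  · intro hext
    refine isExtremeRay_of_realDiagonal_mem_extremePoints h ?_
    have h1 := conj_mem_extremePoints hext (Unitary.star_mem hU)
    rwa [conj_star_eigenvectorUnitary] at h1
  · intro hext
    have h1 := ((realDiagonal_mem_absolutelyPPT_iff h).1 (realDiagonal_eigenvalues_mem hA hH)).2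
    rw [hspec]
    exact conj_mem_extremePoints (hext.realDiagonal_mem_extremePoints h h1) hU

theorem isUnnormalizedExtreme_diagNine_iff (x : Fin 9 → ℝ) :
    IsUnnormalizedExtreme (diagNine x) ↔ IsExtremeRay x := by
  have hdiag : diagNine x = realDiagonal (x ∘ (finProdFinEquiv : Fin 3 × Fin 3 ≃ Fin (3 * 3))) :=
    rfl
  have hray : IsExtremeRay (x ∘ (finProdFinEquiv : Fin 3 × Fin 3 ≃ Fin (3 * 3))) ↔
    IsExtremeRay x := isExtremeRay_comp_equiv_iff _
  rw [hdiag, ← hray]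
  generalize x ∘ (finProdFinEquiv : Fin 3 × Fin 3 ≃ Fin (3 * 3)) = y
  have smul_ray : ∀ {c : ℝ} {z : Fin 3 × Fin 3 → ℝ}, 0 < c → IsExtremeRay z →
      IsExtremeRay (c • z) := by
    intro c z hc hz
    refine ⟨smul_mem_pptCone hc.le hz.1, smul_ne_zero hc.ne' hz.2.1, fun p hp q hq hpq => ?_⟩
    obtain ⟨e, he⟩ := hz.2.2 _ (smul_mem_pptCone (inv_nonneg.2 hc.le) hp) _
      (smul_mem_pptCone (inv_nonneg.2 hc.le) hq) (by
        rw [← smul_add, hpq, smul_smul, inv_mul_cancel₀ hc.ne', one_smul])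
    refine ⟨e, ?_⟩
    rw [smul_comm, ← he, smul_smul, mul_inv_cancel₀ hc.ne', one_smul]
  constructor
  · rintro ⟨c, hc, hext⟩
    rw [← realDiagonal_smul] at hext
    have h1 := smul_ray (inv_pos.2 hc)
      (isExtremeRay_of_realDiagonal_mem_extremePoints le_rfl hext)
    rwa [smul_smul, inv_mul_cancel₀ hc.ne', one_smul] at h1
  · intro hy
    have hpos := sum_pos_of_mem_pptCone le_rfl hy.1 hy.2.1
    refine ⟨(∑ i, y i)⁻¹, inv_pos.2 hpos, ?_⟩
    rw [← realDiagonal_smul]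
    refine (smul_ray (inv_pos.2 hpos) hy).realDiagonal_mem_extremePoints le_rfl ?_
    simp only [Pi.smul_apply, smul_eq_mul, ← Finset.mul_sum]
    exact inv_mul_cancel₀ hpos.ne'

theorem eigval_eq {m n : ℕ} {A : Matrix (Fin m × Fin n) (Fin m × Fin n) ℂ} (hA : A.IsHermitian)
    {i : ℕ} (j : Fin (Fintype.card (Fin m × Fin n))) (hj : (j : ℕ) + 1 = i) :
    eigval hA i = hA.eigenvalues₀ j := by
  rw [eigval, dif_pos ⟨by omega, by omega⟩]
  congr 1
  apply Fin.ext
  simp only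
  omega

end AbsolutelyPPT

theorem theorem4p5 (n : ℕ) (hn : 3 < n) (ρ : Matrix (Fin 3 × Fin n) (Fin 3 × Fin n) ℂ)
    (hρ : ρ ∈ absolutelyPPT 3 n) :
    ρ ∈ Set.extremePoints ℝ (absolutelyPPT 3 n) ↔
      IsUnnormalizedExtreme (diagNine
          ![eigval (absolutelyPPT_isHermitian hρ) 1,
            eigval (absolutelyPPT_isHermitian hρ) 2,
            eigval (absolutelyPPT_isHermitian hρ) 3,
            eigval (absolutelyPPT_isHermitian hρ) (3 * n - 5),
            eigval (absolutelyPPT_isHermitian hρ) (3 * n - 4),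
            eigval (absolutelyPPT_isHermitian hρ) (3 * n - 3),
            eigval (absolutelyPPT_isHermitian hρ) (3 * n - 2),
            eigval (absolutelyPPT_isHermitian hρ) (3 * n - 1),
            eigval (absolutelyPPT_isHermitian hρ) (3 * n)]) ∧
        ∀ i : ℕ, 4 ≤ i → i ≤ 3 * n - 6 →
          eigval (absolutelyPPT_isHermitian hρ) i = eigval (absolutelyPPT_isHermitian hρ) 3 ∨
          eigval (absolutelyPPT_isHermitian hρ) i =
            eigval (absolutelyPPT_isHermitian hρ) (3 * n - 5) := by
  have hN : 9 ≤ Fintype.card (Fin 3 × Fin n) := nine_le_card hn.le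
  have hcard : Fintype.card (Fin 3 × Fin n) = 3 * n := by simp
  rw [mem_extremePoints_iff_isExtremeRay hn.le hρ, isUnnormalizedExtreme_diagNine_iff]
  have hH := absolutelyPPT_isHermitian hρ
  change IsExtremeRay hH.eigenvalues₀ ↔ IsExtremeRay ![eigval hH 1, eigval hH 2, eigval hH 3,
    eigval hH (3 * n - 5), eigval hH (3 * n - 4), eigval hH (3 * n - 3), eigval hH (3 * n - 2),
    eigval hH (3 * n - 1), eigval hH (3 * n)] ∧ ∀ i : ℕ, 4 ≤ i → i ≤ 3 * n - 6 →
      eigval hH i = eigval hH 3 ∨ eigval hH i = eigval hH (3 * n - 5)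
  have hanti := hH.eigenvalues₀_antitone
  have hmem : hH.eigenvalues₀ ∈ pptCone _ := by
    have h1 := ((realDiagonal_mem_absolutelyPPT_iff hn.le).1
      (realDiagonal_eigenvalues_mem hρ hH)).1
    convert comp_mem_pptCone h1 (Fintype.equivOfCardEq (Fintype.card_fin _)).injective using 1
    ext j
    simp [Matrix.IsHermitian.eigenvalues]
  have hnine : ![eigval hH 1, eigval hH 2, eigval hH 3,
      eigval hH (3 * n - 5), eigval hH (3 * n - 4), eigval hH (3 * n - 3), eigval hH (3 * n - 2),
      eigval hH (3 * n - 1), eigval hH (3 * n)] = hH.eigenvalues₀ ∘ endpoints hN := by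
    ext k
    have hv : ∀ k : Fin 9, (endpoints hN k : ℕ) =
        if (k : ℕ) < 3 then (k : ℕ) else 3 * n - 9 + k := by
      intro k
      unfold endpoints
      split_ifs
      · rfl
      · simp only [hcard]
    have hk := hv k
    fin_cases k <;> exact eigval_eq hH _ (by rw [hk]; simp; try omega)
  have h3 : eigval hH 3 = hH.eigenvalues₀ (endpoints hN 2) := congrFun hnine 2
  have h5 : eigval hH (3 * n - 5) = hH.eigenvalues₀ (endpoints hN 3) := congrFun hnine 3
  rw [hnine, h3, h5]
  constructor
  · intro h
    refine ⟨h.comp_endpoints hN hanti, fun i h4 h6 => ?_⟩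
    have hi : i - 1 < Fintype.card (Fin 3 × Fin n) := by omega
    rw [eigval_eq hH ⟨i - 1, hi⟩ (by simp only; omega)]
    exact h.eq_or_eq hN hanti ⟨i - 1, hi⟩ (by simp only; omega) (by simp only; omega)
  · rintro ⟨h, hmid⟩
    refine isExtremeRay_of_comp_endpoints hN hanti hmem h fun i h3 h6 => ?_
    rw [← eigval_eq hH i rfl]
    exact hmid _ (by omega) (by omega)
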